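/- For each $k\in\mathbb{N}$ let $d_k<n_k$ be natural numbers, let $P_k$ be a centred probability law on $\mathbb{R}^{d_k}$ with covariance matrix $\Sigma_k$, and let $x_{k,1},\dots,x_{k,n_k}$ be i.i.d. with law $P_k$, with empirical covariance $\hat\Sigma_k=\frac1{n_k}\sum_{i=1}^{n_k}x_{k,i}x_{k,i}^T$. Suppose that $n_k\to\infty$, $d_k\to\infty$ and $d_k/n_k\to y\in[0,1)$ as $k\to\infty$. Let $\|\cdot\|$ be the spectral norm. Assume, with $x\sim P_k$: A1. The empirical spectral distribution functions $F_{\Sigma_k}(u)=d_k^{-1}\#\{i:\lambda_i(\Sigma_k)\le u\}$ converge, for almost every $u\ge 0$, to some $F(u)$. A2. $M_k=\sup_{|e|=1}\mathbb{E}(e^Tx)^4$ is bounded in $k$, and $\nu_k=\sup_{\|A\|=1}\mathrm{Var}(x^TAx/d_k)\to0$, where $A$ ranges over real $d_k\times d_k$ matrices. A3. There are constants $0<\sigma_{\min}\le\sigma_{\max}$, not depending on $k$, such that all eigenvalues of every $\Sigma_k$ lie in $[\sigma_{\min},\sigma_{\max}]$ (so $\Sigma_k$ is invertible). Assume moreover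 that the eigenvalues of $\hat\Sigma_k$ are bounded away from zero with probability tending to one: there is $\sigma>0$, not depending on $k$, with $p_k:=\mathbb{P}(\lambda_{\min}(\hat\Sigma_k)<\sigma)\to0$. For $\epsilon>0$ define $\Omega_1(k,\epsilon)$ by \[\mathbb{E}\left[\left(\tfrac{1}{1-d_k/n_k}\hat\Sigma_k+\epsilon I\right)^{-1}\right]=\Sigma_k^{-1}+\Omega_1(k,\epsilon).\] Then $\|\Omega_1\|\to0$ as $n,d\to\infty$ and $\epsilon\to0$, in both of the following senses. (1) (Simultaneous limit.) If $\epsilon_k>0$, $\epsilon_k\to0$ and $p_k=o(\epsilon_k)$, then $\|\Omega_1(k,\epsilon_k)\|\to0$. In particular, if $p_k=0$ for all large $k$, this holds for every positive sequence $\epsilon_k\to0$. (2) (Iterated limit.) $\lim_{\epsilon\to0^+}\limsup_{k\to\infty}\|\Omega_1(k,\epsilon)\|=0$. -/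

import Mathlib

open MeasureTheory ProbabilityTheory Filter Topology Asymptotics
open scoped Matrix ENNReal

noncomputable section

/-- The spectral (Euclidean operator) norm of a real square matrix. -/
def specNorm {d : ℕ} (A : Matrix (Fin d) (Fin d) ℝ) : ℝ :=
  ‖Matrix.toEuclideanCLM (n := Fin d) (𝕜 := ℝ) A‖

/-- The covariance matrix of a probability law on `ℝ^d`. -/
def covMatrix {d : ℕ} (P : Measure (Fin d → ℝ)) : Matrix (Fin d) (Fin d) ℝ :=
  Matrix.of fun i j => cov[fun v : Fin d → ℝ => v i, fun v : Fin d → ℝ => v j; P]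

theorem covMatrix_isHermitian {d : ℕ} (P : Measure (Fin d → ℝ)) :
    (covMatrix P).IsHermitian := by
  ext i j
  simp [covMatrix, covariance_comm]

/-- The empirical spectral distribution function `u ↦ d⁻¹ #{i : λ_i ≤ u}` of a symmetric
matrix, eigenvalues being counted with multiplicity. -/
def esd {d : ℕ} {A : Matrix (Fin d) (Fin d) ℝ} (hA : A.IsHermitian) (u : ℝ) : ℝ :=
  (Nat.card {i : Fin d // hA.eigenvalues i ≤ u} : ℝ) / d

/-- `M = sup_{|e| = 1} E (eᵀx)⁴` for `x` with law `P`, as an extended nonnegative real. -/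
def fourthMoment {d : ℕ} (P : Measure (Fin d → ℝ)) : ℝ≥0∞ :=
  ⨆ (e : Fin d → ℝ) (_ : e ⬝ᵥ e = 1), ∫⁻ v, ENNReal.ofReal ((e ⬝ᵥ v) ^ 4) ∂P

/-- `ν = sup_{‖A‖ = 1} Var (xᵀ A x / d)` for `x` with law `P`, as an extended nonnegative real. -/
def quadVariance {d : ℕ} (P : Measure (Fin d → ℝ)) : ℝ≥0∞ :=
  ⨆ (A : Matrix (Fin d) (Fin d) ℝ) (_ : specNorm A = 1),
    evariance (fun v : Fin d → ℝ => (v ⬝ᵥ (A *ᵥ v)) / d) P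

/-- The empirical covariance `n⁻¹ ∑ xᵢ xᵢᵀ` of the sample `x₁, …, xₙ`. -/
def empCov {n d : ℕ} (x : Fin n → Fin d → ℝ) : Matrix (Fin d) (Fin d) ℝ :=
  (n : ℝ)⁻¹ • ∑ i, Matrix.vecMulVec (x i) (x i)

/-- The entrywise expectation of a random matrix. -/
def matExp {Ω : Type*} [MeasurableSpace Ω] {d : ℕ} (μ : Measure Ω)
    (R : Ω → Matrix (Fin d) (Fin d) ℝ) : Matrix (Fin d) (Fin d) ℝ :=
  Matrix.of fun i j => ∫ ω, R ω i j ∂μ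

/-- The error `E[((1 - d/n)⁻¹ Σ̂ + ε I)⁻¹] - Σ⁻¹`, where `Σ` is the covariance matrix of `P` and
`Σ̂` the empirical covariance of the random sample `X`. -/
def resolventBias {Ω : Type*} [MeasurableSpace Ω] {n d : ℕ} (μ : Measure Ω)
    (P : Measure (Fin d → ℝ)) (X : Fin n → Ω → Fin d → ℝ) (ε : ℝ) :
    Matrix (Fin d) (Fin d) ℝ :=
  matExp μ (fun ω =>
    ((1 - (d : ℝ) / n)⁻¹ • empCov (fun i => X i ω) + ε • (1 : Matrix (Fin d) (Fin d) ℝ))⁻¹)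
    - (covMatrix P)⁻¹

/-- The probability that the empirical covariance of the random sample `X` has an eigenvalue
smaller than `σ`. -/
def smallEigProb {Ω : Type*} [MeasurableSpace Ω] {n d : ℕ} (μ : Measure Ω)
    (X : Fin n → Ω → Fin d → ℝ) (σ : ℝ) : ℝ :=
  μ.real {ω | ∃ t ∈ spectrum ℝ (empCov fun i => X i ω), t < σ}

end

/-! Put c = 1 - d/n, δ = εc and R = (Σ̂ + δI)⁻¹. The scaled resolvent in the statement equals cR, so
the claim is that c E[R] is close to Σ⁻¹.

Leave one observation x out of the sum defining R⁻¹. What remains, B, is independent of x, and R =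
(B + n⁻¹xxᵀ)⁻¹. Sherman–Morrison gives xᵀRv = (1+q)⁻¹ xᵀB⁻¹v with q = n⁻¹xᵀB⁻¹x. Since ν → 0, q is
close in mean square to n⁻¹tr(ΣB⁻¹), and restoring x moves this trace term by O(1/n). Hence
E[(uᵀx)(xᵀRv)] is close to E[β uᵀΣRv], where β = (1 + n⁻¹tr(ΣR))⁻¹ (`abs_integral_bilin_sub_le`).
Averaging over observations and using Σ̂R = I - δR gives uᵀv - δE[uᵀRv] ≈ E[β uᵀΣRv].

The same leave-one-out identity determines β. Each 1 - n⁻¹xᵢᵀRxᵢ equals its own (1+q)⁻¹, hence is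
close to β in L¹, while their average is exactly 1 - d/n + δ n⁻¹tr R. So β ≈ c + δ n⁻¹tr R in L¹;
concentration of the trace of R itself is never needed. Consequently uᵀv ≈ c E[uᵀΣRv] up to terms
carrying a factor δ. These are O(δ) when λ_min(Σ̂) ≥ σ, and on the complement they cost at most a
constant depending on δ times p (`abs_sub_integral_bilin_ridge_inv_le`). Replacing u by a multiple
of Σ⁻¹u gives the bias.

For fixed ε all errors except the O(δ) one vanish as k → ∞, which is the iterated limit. The error
bounds involve powers of δ⁻¹, so they do not give the simultaneous limit directly. There ε_k is
compared with a fixed ε' by the resolvent identity, at cost ε'σ⁻² + 2p/ε_k, and p = o(ε_k) finishes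
(`specNorm_resolventBias_le_add`). -/

section LinearAlgebra

/-! ### Spectral norm through quadratic and bilinear forms. -/

variable {d : ℕ}

theorem dotProduct_self_nonneg' (v : Fin d → ℝ) : 0 ≤ v ⬝ᵥ v :=
  Finset.sum_nonneg fun _ _ => mul_self_nonneg _

theorem norm_toLp_sq (v : Fin d → ℝ) : ‖WithLp.toLp 2 v‖ ^ 2 = v ⬝ᵥ v := by
  rw [EuclideanSpace.norm_sq_eq]
  simp [dotProduct, pow_two]

theorem sq_dotProduct_le (u v : Fin d → ℝ) : (u ⬝ᵥ v) ^ 2 ≤ (u ⬝ᵥ u) * (v ⬝ᵥ v) := by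
  have := Finset.sum_mul_sq_le_sq_mul_sq Finset.univ u v
  simpa [dotProduct, pow_two] using this

theorem abs_dotProduct_le {u v : Fin d → ℝ} {a b : ℝ} (ha : 0 ≤ a) (hb : 0 ≤ b)
    (hu : u ⬝ᵥ u ≤ a ^ 2) (hv : v ⬝ᵥ v ≤ b ^ 2) : |u ⬝ᵥ v| ≤ a * b := by
  refine abs_le_of_sq_le_sq ((sq_dotProduct_le u v).trans ?_) (by positivity)
  rw [mul_pow]
  exact mul_le_mul hu hv (dotProduct_self_nonneg' v) (by positivity)

theorem specNorm_nonneg (A : Matrix (Fin d) (Fin d) ℝ) : 0 ≤ specNorm A := norm_nonneg _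

theorem mulVec_self_le_specNorm (A : Matrix (Fin d) (Fin d) ℝ) (v : Fin d → ℝ) :
    (A *ᵥ v) ⬝ᵥ (A *ᵥ v) ≤ specNorm A ^ 2 * (v ⬝ᵥ v) := by
  have h := (Matrix.toEuclideanCLM (n := Fin d) (𝕜 := ℝ) A).le_opNorm (WithLp.toLp 2 v)
  rw [Matrix.toEuclideanCLM_toLp] at h
  rw [← norm_toLp_sq, ← norm_toLp_sq, ← mul_pow]
  exact pow_le_pow_left₀ (norm_nonneg _) h 2

theorem abs_quadForm_le_specNorm (A : Matrix (Fin d) (Fin d) ℝ) (v : Fin d → ℝ) :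
    |v ⬝ᵥ A *ᵥ v| ≤ specNorm A * (v ⬝ᵥ v) := by
  have hv := dotProduct_self_nonneg' v
  have h := abs_dotProduct_le (u := v) (v := A *ᵥ v) (a := √(v ⬝ᵥ v))
    (b := specNorm A * √(v ⬝ᵥ v)) (Real.sqrt_nonneg _)
    (mul_nonneg (specNorm_nonneg A) (Real.sqrt_nonneg _)) (by rw [Real.sq_sqrt hv])
    (by rw [mul_pow, Real.sq_sqrt hv]; exact mulVec_self_le_specNorm A v)
  calc _ ≤ _ := h
    _ = specNorm A * (√(v ⬝ᵥ v) ^ 2) := by ring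
    _ = _ := by rw [Real.sq_sqrt hv]

theorem specNorm_le_of_forall_mulVec {A : Matrix (Fin d) (Fin d) ℝ} {c : ℝ} (hc : 0 ≤ c)
    (h : ∀ v, (A *ᵥ v) ⬝ᵥ (A *ᵥ v) ≤ c ^ 2 * (v ⬝ᵥ v)) : specNorm A ≤ c := by
  refine ContinuousLinearMap.opNorm_le_bound _ hc fun v => ?_
  obtain ⟨v, rfl⟩ := (WithLp.toLp_surjective 2) v
  rw [Matrix.toEuclideanCLM_toLp]
  refine le_of_sq_le_sq ?_ (by positivity)
  rw [mul_pow, norm_toLp_sq, norm_toLp_sq]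
  exact h v

/-- Test against u = Av/|Av|. This reduces every matrix estimate to scalar ones for fixed u and v;
the closed unit ball is used so that shrunken test vectors remain admissible. -/
theorem specNorm_le_of_forall_bilin {A : Matrix (Fin d) (Fin d) ℝ} {c : ℝ} (hc : 0 ≤ c)
    (h : ∀ u v : Fin d → ℝ, u ⬝ᵥ u ≤ 1 → v ⬝ᵥ v ≤ 1 → |u ⬝ᵥ A *ᵥ v| ≤ c) : specNorm A ≤ c := by
  have key : ∀ v : Fin d → ℝ, v ⬝ᵥ v ≤ 1 → (A *ᵥ v) ⬝ᵥ (A *ᵥ v) ≤ c ^ 2 := by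
    intro v hv
    set w := A *ᵥ v with hw
    set r := √(w ⬝ᵥ w) with hr
    have hr2 : r ^ 2 = w ⬝ᵥ w := Real.sq_sqrt (dotProduct_self_nonneg' w)
    have hr0 : 0 ≤ r := Real.sqrt_nonneg _
    rcases hr0.eq_or_lt with h0 | h0
    · rw [← hr2, ← h0, zero_pow two_ne_zero]; positivity
    · have h1 := h (r⁻¹ • w) v (by
        rw [smul_dotProduct, dotProduct_smul, ← hr2, smul_eq_mul, smul_eq_mul]
        field_simp; rfl) hv
      rw [← hw, smul_dotProduct, ← hr2, smul_eq_mul] at h1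
      have h2 : r⁻¹ * r ^ 2 = r := by field_simp
      rw [h2, abs_of_pos h0] at h1
      rw [← hr2]
      exact pow_le_pow_left₀ hr0 h1 2
  refine specNorm_le_of_forall_mulVec hc fun v => ?_
  set r := √(v ⬝ᵥ v) with hr
  have hr2 : r ^ 2 = v ⬝ᵥ v := Real.sq_sqrt (dotProduct_self_nonneg' v)
  have hr0 : 0 ≤ r := Real.sqrt_nonneg _
  rcases hr0.eq_or_lt with h0 | h0
  · have : v = 0 := by
      rw [← dotProduct_self_eq_zero, ← hr2, ← h0]; norm_num
    simp [this]
  · have h1 := key (r⁻¹ • v) (by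
        rw [smul_dotProduct, dotProduct_smul, ← hr2, smul_eq_mul, smul_eq_mul]
        field_simp; rfl)
    rw [Matrix.mulVec_smul, smul_dotProduct, dotProduct_smul, smul_eq_mul, smul_eq_mul] at h1
    rw [← hr2]
    calc _ = r ^ 2 * (r⁻¹ * (r⁻¹ * (A *ᵥ v ⬝ᵥ A *ᵥ v))) := by field_simp
      _ ≤ r ^ 2 * c ^ 2 := by gcongr
      _ = _ := by ring

/-- A symmetric matrix bounded below by `δ` in the Loewner order. -/
structure SymmCoercive (δ : ℝ) (B : Matrix (Fin d) (Fin d) ℝ) : Prop where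
  symm : B.IsSymm
  le : ∀ v, δ * (v ⬝ᵥ v) ≤ v ⬝ᵥ B *ᵥ v

theorem Matrix.IsSymm.dotProduct_mulVec_comm {B : Matrix (Fin d) (Fin d) ℝ} (h : B.IsSymm)
    (u v : Fin d → ℝ) : u ⬝ᵥ B *ᵥ v = (B *ᵥ u) ⬝ᵥ v := by
  rw [Matrix.dotProduct_mulVec, ← Matrix.mulVec_transpose, h.eq]

/-! ### Inverses of coercive matrices and rank-one updates. -/

namespace SymmCoercive

variable {δ : ℝ} {B : Matrix (Fin d) (Fin d) ℝ}

theorem posDef (hB : SymmCoercive δ B) (hδ : 0 < δ) : B.PosDef := by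
  refine Matrix.PosDef.of_dotProduct_mulVec_pos ?_ fun v hv => ?_
  · have := hB.symm
    rwa [Matrix.IsHermitian, Matrix.conjTranspose_eq_transpose_of_trivial]
  · have h0 : v ⬝ᵥ v ≠ 0 := by rwa [Ne, dotProduct_self_eq_zero]
    have h1 := (dotProduct_self_nonneg' v).lt_of_ne' h0
    exact (mul_pos hδ h1).trans_le (by simpa using hB.le v)

theorem isUnit_det (hB : SymmCoercive δ B) (hδ : 0 < δ) : IsUnit B.det :=
  (Matrix.isUnit_iff_isUnit_det B).1 (hB.posDef hδ).isUnit

theorem mulVec_inv_mulVec (hB : SymmCoercive δ B) (hδ : 0 < δ) (v : Fin d → ℝ) :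
    B *ᵥ B⁻¹ *ᵥ v = v := by
  rw [Matrix.mulVec_mulVec, Matrix.mul_nonsing_inv _ (hB.isUnit_det hδ), Matrix.one_mulVec]

theorem inv_mulVec_mulVec (hB : SymmCoercive δ B) (hδ : 0 < δ) (v : Fin d → ℝ) :
    B⁻¹ *ᵥ B *ᵥ v = v := by
  rw [Matrix.mulVec_mulVec, Matrix.nonsing_inv_mul _ (hB.isUnit_det hδ), Matrix.one_mulVec]

theorem inv_isSymm (hB : SymmCoercive δ B) : (B⁻¹).IsSymm := by
  rw [Matrix.IsSymm, Matrix.transpose_nonsing_inv, hB.symm.eq]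

/-- Coercivity tested at B⁻¹v. All later bounds on B⁻¹ come from this inequality. -/
theorem mul_inv_mulVec_self_le (hB : SymmCoercive δ B) (hδ : 0 < δ) (v : Fin d → ℝ) :
    δ * ((B⁻¹ *ᵥ v) ⬝ᵥ (B⁻¹ *ᵥ v)) ≤ v ⬝ᵥ B⁻¹ *ᵥ v := by
  have := hB.le (B⁻¹ *ᵥ v)
  rwa [hB.mulVec_inv_mulVec hδ, dotProduct_comm _ v] at this

theorem quadForm_inv_nonneg (hB : SymmCoercive δ B) (hδ : 0 < δ) (v : Fin d → ℝ) :
    0 ≤ v ⬝ᵥ B⁻¹ *ᵥ v :=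
  (mul_nonneg hδ.le (dotProduct_self_nonneg' _)).trans (hB.mul_inv_mulVec_self_le hδ v)

theorem inv_mulVec_self_le (hB : SymmCoercive δ B) (hδ : 0 < δ) (v : Fin d → ℝ) :
    (B⁻¹ *ᵥ v) ⬝ᵥ (B⁻¹ *ᵥ v) ≤ δ⁻¹ ^ 2 * (v ⬝ᵥ v) := by
  set w := B⁻¹ *ᵥ v
  have h1 := hB.mul_inv_mulVec_self_le hδ v
  have h2 := sq_dotProduct_le v w
  have h3 := dotProduct_self_nonneg' w
  have h4 : (δ * (w ⬝ᵥ w)) ^ 2 ≤ (v ⬝ᵥ v) * (w ⬝ᵥ w) :=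
    (pow_le_pow_left₀ (mul_nonneg hδ.le h3) h1 2).trans h2
  have h5 : δ ^ 2 * (w ⬝ᵥ w) ≤ v ⬝ᵥ v := by
    rcases h3.eq_or_lt with h0 | h0
    · rw [← h0, mul_zero]; exact dotProduct_self_nonneg' v
    · exact le_of_mul_le_mul_right (by linarith [h4]) h0
  rw [inv_pow, ← div_eq_inv_mul, le_div_iff₀ (by positivity)]
  linarith

theorem inv_mulVec_self_le_of_le_one (hB : SymmCoercive δ B) (hδ : 0 < δ) {v : Fin d → ℝ}
    (hv : v ⬝ᵥ v ≤ 1) : (B⁻¹ *ᵥ v) ⬝ᵥ (B⁻¹ *ᵥ v) ≤ δ⁻¹ ^ 2 :=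
  (hB.inv_mulVec_self_le hδ v).trans (mul_le_of_le_one_right (by positivity) hv)

theorem abs_bilin_inv_le (hB : SymmCoercive δ B) (hδ : 0 < δ) {u v : Fin d → ℝ}
    (hu : u ⬝ᵥ u ≤ 1) (hv : v ⬝ᵥ v ≤ 1) : |u ⬝ᵥ B⁻¹ *ᵥ v| ≤ δ⁻¹ := by
  have := abs_dotProduct_le zero_le_one (inv_nonneg.2 hδ.le) (hu.trans (by norm_num))
    (hB.inv_mulVec_self_le_of_le_one hδ hv)
  rwa [one_mul] at this

theorem specNorm_inv_le (hB : SymmCoercive δ B) (hδ : 0 < δ) : specNorm B⁻¹ ≤ δ⁻¹ :=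
  specNorm_le_of_forall_mulVec (inv_nonneg.2 hδ.le) (hB.inv_mulVec_self_le hδ)

theorem trace_inv_le (hB : SymmCoercive δ B) (hδ : 0 < δ) : (B⁻¹).trace ≤ d * δ⁻¹ := by
  have h : ∀ i, B⁻¹ i i ≤ δ⁻¹ := by
    intro i
    have := hB.abs_bilin_inv_le hδ (u := Pi.single i 1) (v := Pi.single i 1) (by simp) (by simp)
    simpa using (le_abs_self _).trans this
  calc _ ≤ ∑ _i : Fin d, δ⁻¹ := Finset.sum_le_sum fun i _ => h i
    _ = _ := by simp

theorem trace_inv_nonneg (hB : SymmCoercive δ B) (hδ : 0 < δ) : 0 ≤ (B⁻¹).trace :=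
  Finset.sum_nonneg fun i _ => by
    simpa using hB.quadForm_inv_nonneg hδ (Pi.single i 1)

theorem mono (hB : SymmCoercive δ B) {δ' : ℝ} (h : δ' ≤ δ) : SymmCoercive δ' B :=
  ⟨hB.symm, fun v => (mul_le_mul_of_nonneg_right h (dotProduct_self_nonneg' v)).trans (hB.le v)⟩

theorem add_vecMulVec (hB : SymmCoercive δ B) {c : ℝ} (hc : 0 ≤ c) (x : Fin d → ℝ) :
    SymmCoercive δ (B + c • Matrix.vecMulVec x x) := by
  refine ⟨?_, fun v => ?_⟩
  · rw [Matrix.IsSymm, Matrix.transpose_add, hB.symm.eq, Matrix.transpose_smul,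
      Matrix.transpose_vecMulVec]
  · have h1 : v ⬝ᵥ (B + c • Matrix.vecMulVec x x) *ᵥ v = v ⬝ᵥ B *ᵥ v + c * (x ⬝ᵥ v) ^ 2 := by
      rw [Matrix.add_mulVec, dotProduct_add, Matrix.smul_mulVec, Matrix.vecMulVec_mulVec]
      simp only [dotProduct_smul, dotProduct_comm v x, MulOpposite.smul_eq_mul_unop, MulOpposite.unop_op, smul_eq_mul]
      ring
    rw [h1]
    exact (hB.le v).trans (le_add_of_nonneg_right (by positivity))

/-- The Sherman–Morrison formula, applied to a vector. -/
theorem inv_add_vecMulVec_mulVec (hB : SymmCoercive δ B) (hδ : 0 < δ) {c : ℝ} (hc : 0 ≤ c)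
    (x v : Fin d → ℝ) :
    (B + c • Matrix.vecMulVec x x)⁻¹ *ᵥ v = B⁻¹ *ᵥ v -
      (c * (1 + c * (x ⬝ᵥ B⁻¹ *ᵥ x))⁻¹ * (x ⬝ᵥ B⁻¹ *ᵥ v)) • B⁻¹ *ᵥ x := by
  have hq := hB.quadForm_inv_nonneg hδ x
  set q := x ⬝ᵥ B⁻¹ *ᵥ x with hqd
  set b := x ⬝ᵥ B⁻¹ *ᵥ v with hb
  have hne : 1 + c * q ≠ 0 := by positivity
  have h : (B + c • Matrix.vecMulVec x x) *ᵥ (B⁻¹ *ᵥ v - (c * (1 + c * q)⁻¹ * b) • B⁻¹ *ᵥ x)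
      = v := by
    rw [Matrix.mulVec_sub, Matrix.mulVec_smul, Matrix.add_mulVec, Matrix.add_mulVec,
      hB.mulVec_inv_mulVec hδ, hB.mulVec_inv_mulVec hδ, Matrix.smul_mulVec, Matrix.smul_mulVec,
      Matrix.vecMulVec_mulVec, Matrix.vecMulVec_mulVec, ← hb, ← hqd]
    ext i
    simp
    field_simp
    ring
  conv_lhs => rw [← h]
  exact (hB.add_vecMulVec hc x).inv_mulVec_mulVec hδ _

theorem inv_add_vecMulVec (hB : SymmCoercive δ B) (hδ : 0 < δ) {c : ℝ} (hc : 0 ≤ c)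
    (x : Fin d → ℝ) :
    (B + c • Matrix.vecMulVec x x)⁻¹ = B⁻¹ -
      (c * (1 + c * (x ⬝ᵥ B⁻¹ *ᵥ x))⁻¹) • Matrix.vecMulVec (B⁻¹ *ᵥ x) (B⁻¹ *ᵥ x) := by
  refine Matrix.ext_of_mulVec_single fun i => ?_
  rw [hB.inv_add_vecMulVec_mulVec hδ hc, Matrix.sub_mulVec, Matrix.smul_mulVec,
    Matrix.vecMulVec_mulVec, hB.inv_isSymm.dotProduct_mulVec_comm x (Pi.single i 1)]
  simp [smul_smul]

/-- The leave-one-out step: the dependence of the updated inverse on x collapses to one scalar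
factor in front of a form in B⁻¹. -/
theorem inv_add_vecMulVec_mulVec_self (hB : SymmCoercive δ B) (hδ : 0 < δ) {c : ℝ} (hc : 0 ≤ c)
    (x v : Fin d → ℝ) :
    x ⬝ᵥ (B + c • Matrix.vecMulVec x x)⁻¹ *ᵥ v =
      (1 + c * (x ⬝ᵥ B⁻¹ *ᵥ x))⁻¹ * (x ⬝ᵥ B⁻¹ *ᵥ v) := by
  have hq := hB.quadForm_inv_nonneg hδ x
  rw [hB.inv_add_vecMulVec_mulVec hδ hc, dotProduct_sub, dotProduct_smul, smul_eq_mul]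
  have hne : 1 + c * (x ⬝ᵥ B⁻¹ *ᵥ x) ≠ 0 := by positivity
  field_simp
  ring

end SymmCoercive

theorem continuous_inv_of_symmCoercive {Z : Type*} [TopologicalSpace Z]
    {f : Z → Matrix (Fin d) (Fin d) ℝ} (hf : Continuous f) {δ : ℝ} (hδ : 0 < δ)
    (h : ∀ z, SymmCoercive δ (f z)) : Continuous fun z => (f z)⁻¹ := by
  refine continuous_iff_continuousAt.2 fun z => ?_
  refine ContinuousAt.comp (g := Inv.inv) (continuousAt_matrix_inv _ ?_) hf.continuousAt
  rw [Ring.inverse_eq_inv']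
  exact continuousAt_inv₀ ((h z).isUnit_det hδ).ne_zero

end LinearAlgebra

/-! ### Moment bounds for one observation. -/

section Moments

variable {d : ℕ} {P : Measure (Fin d → ℝ)}

/-- Quantitative form of finiteness of the directional fourth moments. -/
structure FourthMomentBound (P : Measure (Fin d → ℝ)) (M : ℝ) : Prop where
  nonneg : 0 ≤ M
  integrable : ∀ w : Fin d → ℝ, Integrable (fun x => (w ⬝ᵥ x) ^ 4) P
  le : ∀ w : Fin d → ℝ, ∫ x, (w ⬝ᵥ x) ^ 4 ∂P ≤ M * (w ⬝ᵥ w) ^ 2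

theorem continuous_dotProduct_right (w : Fin d → ℝ) : Continuous fun x : Fin d → ℝ => w ⬝ᵥ x :=
  continuous_const.dotProduct continuous_id

/-- Homogeneity of degree four extends the bound from unit vectors to all vectors; finiteness of the
extended-real supremum supplies integrability. -/
theorem fourthMomentBound_of_le {C : ℝ≥0∞} (hC : C ≠ ∞) (h : fourthMoment P ≤ C) :
    FourthMomentBound P C.toReal := by
  have hunit : ∀ e : Fin d → ℝ, e ⬝ᵥ e = 1 →
      Integrable (fun x => (e ⬝ᵥ x) ^ 4) P ∧ ∫ x, (e ⬝ᵥ x) ^ 4 ∂P ≤ C.toReal := by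
    intro e he
    have h1 : ∫⁻ v, ENNReal.ofReal ((e ⬝ᵥ v) ^ 4) ∂P ≤ C :=
      (le_iSup₂ (f := fun (e : Fin d → ℝ) (_ : e ⬝ᵥ e = 1) =>
        ∫⁻ v, ENNReal.ofReal ((e ⬝ᵥ v) ^ 4) ∂P) e he).trans h
    have hm : AEStronglyMeasurable (fun x => (e ⬝ᵥ x) ^ 4) P :=
      ((continuous_dotProduct_right e).pow 4).aestronglyMeasurable
    have hp : 0 ≤ᵐ[P] fun x => (e ⬝ᵥ x) ^ 4 := ae_of_all _ fun x => by positivity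
    refine ⟨(lintegral_ofReal_ne_top_iff_integrable hm hp).1 (ne_top_of_le_ne_top hC h1), ?_⟩
    rw [integral_eq_lintegral_of_nonneg_ae hp hm]
    exact ENNReal.toReal_mono hC h1
  have hgen : ∀ w : Fin d → ℝ, Integrable (fun x => (w ⬝ᵥ x) ^ 4) P ∧
      ∫ x, (w ⬝ᵥ x) ^ 4 ∂P ≤ C.toReal * (w ⬝ᵥ w) ^ 2 := by
    intro w
    set r := √(w ⬝ᵥ w) with hr
    have hr2 : r ^ 2 = w ⬝ᵥ w := Real.sq_sqrt (dotProduct_self_nonneg' w)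
    rcases (Real.sqrt_nonneg (w ⬝ᵥ w)).eq_or_lt with h0 | h0
    · have : w = 0 := by
        rw [← dotProduct_self_eq_zero, ← hr2, hr, ← h0]; norm_num
      simp [this]
    · have hne : r ≠ 0 := h0.ne'
      have h1 := hunit (r⁻¹ • w) (by
        rw [smul_dotProduct, dotProduct_smul, ← hr2, smul_eq_mul, smul_eq_mul]
        field_simp)
      have h2 : (fun x : Fin d → ℝ => (w ⬝ᵥ x) ^ 4) = fun x => r ^ 4 * ((r⁻¹ • w) ⬝ᵥ x) ^ 4 := by
        funext x
        rw [smul_dotProduct, smul_eq_mul]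
        field_simp
      rw [h2]
      refine ⟨h1.1.const_mul _, ?_⟩
      rw [integral_const_mul, ← hr2]
      calc _ ≤ r ^ 4 * C.toReal := by gcongr; exact h1.2
        _ = _ := by ring
  exact ⟨ENNReal.toReal_nonneg, fun w => (hgen w).1, fun w => (hgen w).2⟩

namespace FourthMomentBound

variable {M : ℝ}

theorem integrable_self_sq (h : FourthMomentBound P M) :
    Integrable (fun x : Fin d → ℝ => (x ⬝ᵥ x) ^ 2) P := by
  have h1 : Integrable (fun x : Fin d → ℝ => (d : ℝ) * ∑ i, x i ^ 4) P :=
    (integrable_finsetSum _ fun i _ => by simpa using h.integrable (Pi.single i 1)).const_mul _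
  refine h1.mono' ((continuous_id.dotProduct continuous_id).pow 2).aestronglyMeasurable
    (ae_of_all _ fun x => ?_)
  rw [Real.norm_eq_abs, abs_of_nonneg (by positivity)]
  have := sq_sum_le_card_mul_sum_sq (s := (Finset.univ : Finset (Fin d))) (f := fun i => x i * x i)
  simp only [Finset.card_univ, Fintype.card_fin] at this
  refine this.trans (le_of_eq ?_)
  congr 1
  exact Finset.sum_congr rfl fun i _ => by ring

theorem integrable_quadForm_sq (h : FourthMomentBound P M) (A : Matrix (Fin d) (Fin d) ℝ) :
    Integrable (fun x : Fin d → ℝ => (x ⬝ᵥ A *ᵥ x) ^ 2) P := by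
  refine (h.integrable_self_sq.const_mul (specNorm A ^ 2)).mono'
    (by fun_prop) (ae_of_all _ fun x => ?_)
  rw [Real.norm_eq_abs, abs_of_nonneg (by positivity), ← mul_pow]
  exact sq_le_sq' (abs_le.1 (abs_quadForm_le_specNorm A x)).1 (abs_le.1 (abs_quadForm_le_specNorm A x)).2

theorem memLp_quadForm (h : FourthMomentBound P M) (A : Matrix (Fin d) (Fin d) ℝ) :
    MemLp (fun x : Fin d → ℝ => x ⬝ᵥ A *ᵥ x) 2 P :=
  (memLp_two_iff_integrable_sq (by fun_prop)).2 (h.integrable_quadForm_sq A)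

variable [IsProbabilityMeasure P]

theorem integrable_sq (h : FourthMomentBound P M) (w : Fin d → ℝ) :
    Integrable (fun x => (w ⬝ᵥ x) ^ 2) P := by
  refine ((integrable_const (1 : ℝ)).add (h.integrable w)).mono'
    ((continuous_dotProduct_right w).pow 2).aestronglyMeasurable (ae_of_all _ fun x => ?_)
  rw [Real.norm_eq_abs, abs_of_nonneg (by positivity)]
  simp only [Pi.add_apply]
  nlinarith [sq_nonneg ((w ⬝ᵥ x) ^ 2 - 1)]

/-- Integrate the pointwise bound a² ≤ r + a⁴/r with r = |w|². The constant 1 + M is crude, but only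
its independence of k matters. -/
theorem integral_sq_le (h : FourthMomentBound P M) (w : Fin d → ℝ) :
    ∫ x, (w ⬝ᵥ x) ^ 2 ∂P ≤ (1 + M) * (w ⬝ᵥ w) := by
  rcases (dotProduct_self_nonneg' w).eq_or_lt with h0 | h0
  · have : w = 0 := by rw [← dotProduct_self_eq_zero, ← h0]
    simp [this]
  · set r := w ⬝ᵥ w
    calc ∫ x, (w ⬝ᵥ x) ^ 2 ∂P ≤ ∫ x, (r + r⁻¹ * (w ⬝ᵥ x) ^ 4) ∂P := by
          refine integral_mono (h.integrable_sq w)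
            ((integrable_const _).add ((h.integrable w).const_mul _)) fun x => ?_
          have : r + r⁻¹ * (w ⬝ᵥ x) ^ 4 - (w ⬝ᵥ x) ^ 2 =
            r⁻¹ * (((w ⬝ᵥ x) ^ 2 - r / 2) ^ 2 + 3 / 4 * r ^ 2) := by
            field_simp; ring
          have h2 : 0 ≤ r⁻¹ * (((w ⬝ᵥ x) ^ 2 - r / 2) ^ 2 + 3 / 4 * r ^ 2) := by positivity
          simp only
          linarith
      _ = r + r⁻¹ * ∫ x, (w ⬝ᵥ x) ^ 4 ∂P := by
          rw [integral_add (integrable_const _) ((h.integrable w).const_mul _),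
            integral_const_mul]
          simp
      _ ≤ r + r⁻¹ * (M * r ^ 2) := by gcongr; exact h.le w
      _ = _ := by field_simp

theorem integrable_mul (h : FourthMomentBound P M) (u w : Fin d → ℝ) :
    Integrable (fun x => (u ⬝ᵥ x) * (w ⬝ᵥ x)) P := by
  refine ((h.integrable_sq u).add (h.integrable_sq w)).mono'
    ((continuous_dotProduct_right u).mul (continuous_dotProduct_right w)).aestronglyMeasurable
    (ae_of_all _ fun x => ?_)
  rw [Real.norm_eq_abs, Pi.add_apply]
  exact abs_le.2 ⟨by nlinarith [sq_nonneg (u ⬝ᵥ x + w ⬝ᵥ x)],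
    by nlinarith [sq_nonneg (u ⬝ᵥ x - w ⬝ᵥ x)]⟩

theorem integral_abs_mul_le (h : FourthMomentBound P M) (u w : Fin d → ℝ) :
    ∫ x, |(u ⬝ᵥ x) * (w ⬝ᵥ x)| ∂P ≤ (1 + M) * ((u ⬝ᵥ u) + (w ⬝ᵥ w)) / 2 := by
  calc ∫ x, |(u ⬝ᵥ x) * (w ⬝ᵥ x)| ∂P ≤ ∫ x, ((u ⬝ᵥ x) ^ 2 + (w ⬝ᵥ x) ^ 2) / 2 ∂P := by
        refine integral_mono (h.integrable_mul u w).abs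
          (((h.integrable_sq u).add (h.integrable_sq w)).div_const 2) fun x => ?_
        exact abs_le.2 ⟨by nlinarith [sq_nonneg (u ⬝ᵥ x + w ⬝ᵥ x)],
          by nlinarith [sq_nonneg (u ⬝ᵥ x - w ⬝ᵥ x)]⟩
    _ = (∫ x, (u ⬝ᵥ x) ^ 2 ∂P + ∫ x, (w ⬝ᵥ x) ^ 2 ∂P) / 2 := by
        rw [integral_div, integral_add (h.integrable_sq u) (h.integrable_sq w)]
    _ ≤ _ := by linarith [h.integral_sq_le u, h.integral_sq_le w]

theorem integrable_coord_mul (h : FourthMomentBound P M) (i j : Fin d) :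
    Integrable (fun x : Fin d → ℝ => x i * x j) P := by
  simpa using h.integrable_mul (Pi.single i 1) (Pi.single j 1)

theorem integrable_quadForm (h : FourthMomentBound P M) (A : Matrix (Fin d) (Fin d) ℝ) :
    Integrable (fun x : Fin d → ℝ => x ⬝ᵥ A *ᵥ x) P :=
  (h.memLp_quadForm A).integrable one_le_two

end FourthMomentBound

theorem covMatrix_apply (hmean : ∀ i, ∫ v, v i ∂P = 0) (i j : Fin d) :
    covMatrix P i j = ∫ x, x i * x j ∂P := by
  simp [covMatrix, covariance, hmean]

theorem covMatrix_isSymm (P : Measure (Fin d → ℝ)) : (covMatrix P).IsSymm := by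
  have := covMatrix_isHermitian P
  rwa [Matrix.IsHermitian, Matrix.conjTranspose_eq_transpose_of_trivial] at this

variable {M : ℝ} [IsProbabilityMeasure P]

/-- Centring makes the covariance the matrix of second moments, so tr(ΣA) is the mean of the
quadratic form and its deviation from the trace is controlled by the variance ν. -/
theorem trace_covMatrix_mul (h : FourthMomentBound P M) (hmean : ∀ i, ∫ v, v i ∂P = 0)
    (A : Matrix (Fin d) (Fin d) ℝ) : (covMatrix P * A).trace = ∫ x, x ⬝ᵥ A *ᵥ x ∂P := by
  have h1 : (fun x : Fin d → ℝ => x ⬝ᵥ A *ᵥ x) = fun x => ∑ i, ∑ j, A i j * (x i * x j) := by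
    funext x
    simp only [dotProduct, Matrix.mulVec, Finset.mul_sum]
    exact Finset.sum_congr rfl fun i _ => Finset.sum_congr rfl fun j _ => by ring
  have h2 : ∫ x : Fin d → ℝ, ∑ i, ∑ j, A i j * (x i * x j) ∂P =
      ∑ i, ∑ j, A i j * ∫ x : Fin d → ℝ, x i * x j ∂P :=
    (integral_finsetSum _ fun i _ => integrable_finsetSum _ fun j _ =>
      (h.integrable_coord_mul i j).const_mul _).trans <| Finset.sum_congr rfl fun i _ =>
        (integral_finsetSum _ fun j _ => (h.integrable_coord_mul i j).const_mul _).trans <|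
          Finset.sum_congr rfl fun j _ => integral_const_mul _ _
  rw [h1, h2, Matrix.trace_mul_comm]
  simp only [Matrix.trace, Matrix.diag, Matrix.mul_apply]
  refine Finset.sum_congr rfl fun i _ => Finset.sum_congr rfl fun j _ => ?_
  rw [covMatrix_apply hmean]
  simp_rw [mul_comm]

theorem dotProduct_covMatrix_mulVec (h : FourthMomentBound P M) (hmean : ∀ i, ∫ v, v i ∂P = 0)
    (u w : Fin d → ℝ) : u ⬝ᵥ covMatrix P *ᵥ w = ∫ x, (u ⬝ᵥ x) * (w ⬝ᵥ x) ∂P := by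
  have h1 := trace_covMatrix_mul h hmean (Matrix.vecMulVec w u)
  rw [Matrix.mul_vecMulVec, Matrix.trace_vecMulVec, dotProduct_comm] at h1
  rw [h1]
  congr 1
  funext x
  rw [Matrix.vecMulVec_mulVec]
  simp [dotProduct_smul, dotProduct_comm x w]

theorem specNorm_covMatrix_le (h : FourthMomentBound P M) (hmean : ∀ i, ∫ v, v i ∂P = 0) :
    specNorm (covMatrix P) ≤ 1 + M := by
  have hM := h.nonneg
  refine specNorm_le_of_forall_bilin (by positivity) fun u w hu hw => ?_
  rw [dotProduct_covMatrix_mulVec h hmean]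
  refine (abs_integral_le_integral_abs).trans ((h.integral_abs_mul_le u w).trans ?_)
  nlinarith

theorem covMatrix_mulVec_self_le (h : FourthMomentBound P M) (hmean : ∀ i, ∫ v, v i ∂P = 0)
    {u : Fin d → ℝ} (hu : u ⬝ᵥ u ≤ 1) :
    (covMatrix P *ᵥ u) ⬝ᵥ (covMatrix P *ᵥ u) ≤ (1 + M) ^ 2 := by
  have h1 := specNorm_covMatrix_le h hmean
  have h2 := specNorm_nonneg (covMatrix P)
  calc _ ≤ specNorm (covMatrix P) ^ 2 * (u ⬝ᵥ u) := mulVec_self_le_specNorm _ _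
    _ ≤ (1 + M) ^ 2 * 1 := by gcongr; exact dotProduct_self_nonneg' u
    _ = _ := mul_one _

/-- The place where ν enters: A is rescaled to unit spectral norm, and passing from normalisation by
d to normalisation by N ≥ d only shrinks the variance. -/
theorem integral_quadForm_sub_trace_sq_le (h : FourthMomentBound P M)
    (hmean : ∀ i, ∫ v, v i ∂P = 0) {s : ℝ} (hs : quadVariance P ≤ ENNReal.ofReal (s ^ 2))
    {N : ℝ} (hd : 0 < d) (hN : d ≤ N) {A : Matrix (Fin d) (Fin d) ℝ} {c : ℝ}
    (hA : specNorm A ≤ c) :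
    ∫ x, (N⁻¹ * (x ⬝ᵥ A *ᵥ x) - N⁻¹ * (covMatrix P * A).trace) ^ 2 ∂P ≤ s ^ 2 * c ^ 2 := by
  have hd' : (0 : ℝ) < d := by exact_mod_cast hd
  have hN' := hd'.trans_le hN
  have ha := specNorm_nonneg A
  set f : (Fin d → ℝ) → ℝ := fun x => (x ⬝ᵥ A *ᵥ x) / d with hf
  have hfL : MemLp f 2 P := by
    simpa [hf, div_eq_inv_mul] using (h.memLp_quadForm A).const_mul (d : ℝ)⁻¹
  have hvar : variance f P ≤ s ^ 2 * specNorm A ^ 2 := by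
    -- The zero matrix cannot be normalised and is treated apart.
    rcases ha.eq_or_lt with h0 | h0
    · have hA0 : A = 0 := by
        have : ‖Matrix.toEuclideanCLM (n := Fin d) (𝕜 := ℝ) A‖ = 0 := h0.symm
        simpa using this
      have : f = 0 := by funext x; simp [hf, hA0]
      rw [this, variance_zero]; positivity
    · set A' := (specNorm A)⁻¹ • A with hA'
      have h1 : specNorm A' = 1 := by
        rw [specNorm, hA', map_smul, norm_smul, Real.norm_eq_abs, abs_of_pos (inv_pos.2 h0)]
        exact inv_mul_cancel₀ h0.ne'
      have h2 : evariance (fun x : Fin d → ℝ => (x ⬝ᵥ A' *ᵥ x) / d) P ≤ ENNReal.ofReal (s ^ 2) :=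
        (le_iSup₂ (f := fun (A : Matrix (Fin d) (Fin d) ℝ) (_ : specNorm A = 1) =>
          evariance (fun v : Fin d → ℝ => (v ⬝ᵥ (A *ᵥ v)) / d) P) A' h1).trans hs
      have h3 : f = fun x : Fin d → ℝ => specNorm A * ((x ⬝ᵥ A' *ᵥ x) / d) := by
        funext x
        rw [hA', Matrix.smul_mulVec, dotProduct_smul, smul_eq_mul, hf]
        field_simp
      have h4 : ENNReal.ofReal (variance f P) ≤ ENNReal.ofReal (s ^ 2 * specNorm A ^ 2) := by
        rw [ofReal_variance hfL, h3, evariance_mul, mul_comm (s ^ 2),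
          ENNReal.ofReal_mul (by positivity)]
        gcongr
      exact (ENNReal.ofReal_le_ofReal_iff (by positivity)).1 h4
  rw [variance_eq_integral hfL.aestronglyMeasurable.aemeasurable] at hvar
  have hmeanf : ∫ x, f x ∂P = (covMatrix P * A).trace / d := by
    rw [trace_covMatrix_mul h hmean, ← integral_div]
  have heq : ∀ x : Fin d → ℝ, (N⁻¹ * (x ⬝ᵥ A *ᵥ x) - N⁻¹ * (covMatrix P * A).trace) ^ 2 =
      (d / N) ^ 2 * (f x - ∫ x, f x ∂P) ^ 2 := by
    intro x
    rw [hmeanf, hf]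
    field_simp
  simp_rw [heq]
  rw [integral_const_mul]
  have h5 : (d / N) ^ 2 ≤ (1 : ℝ) := pow_le_one₀ (by positivity) ((div_le_one hN').2 hN)
  calc _ ≤ 1 * (s ^ 2 * specNorm A ^ 2) :=
        mul_le_mul h5 hvar (integral_nonneg fun x => sq_nonneg _) zero_le_one
    _ ≤ s ^ 2 * c ^ 2 := by rw [one_mul]; gcongr

end Moments

/-! ### Leave-one-out estimates with the other observations frozen. -/

section OneSample

theorem abs_inv_one_add_sub_le {a b : ℝ} (ha : 0 ≤ a) (hb : 0 ≤ b) :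
    |(1 + a)⁻¹ - (1 + b)⁻¹| ≤ |a - b| := by
  have h : (1 + a)⁻¹ - (1 + b)⁻¹ = (b - a) * ((1 + a)⁻¹ * (1 + b)⁻¹) := by field_simp; ring
  rw [h, abs_mul, abs_sub_comm a b, abs_of_nonneg (by positivity : 0 ≤ (1 + a)⁻¹ * (1 + b)⁻¹)]
  refine mul_le_of_le_one_right (abs_nonneg _) (mul_le_one₀ ?_ (by positivity) ?_) <;>
    exact inv_le_one_of_one_le₀ (by linarith)

theorem abs_le_half_add_sq {s : ℝ} (hs : 0 < s) (a b : ℝ) :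
    |a| * |b| ≤ s / 2 * a ^ 2 + s⁻¹ / 2 * b ^ 2 := by
  have h : s / 2 * a ^ 2 + s⁻¹ / 2 * b ^ 2 - |a| * |b| = s⁻¹ / 2 * (s * |a| - |b|) ^ 2 := by
    rw [← sq_abs a, ← sq_abs b]; field_simp; ring
  have : 0 ≤ s⁻¹ / 2 * (s * |a| - |b|) ^ 2 := by positivity
  linarith

variable {d : ℕ}

theorem FourthMomentBound.integral_mul_sq_le {P : Measure (Fin d → ℝ)} {M δ : ℝ}
    (h : FourthMomentBound P M) (hδ : 0 < δ) {u w : Fin d → ℝ} (hu : u ⬝ᵥ u ≤ 1) (hw : w ⬝ᵥ w ≤ δ⁻¹ ^ 2) :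
    Integrable (fun x => ((u ⬝ᵥ x) * (w ⬝ᵥ x)) ^ 2) P ∧
      ∫ x, ((u ⬝ᵥ x) * (w ⬝ᵥ x)) ^ 2 ∂P ≤ M * δ⁻¹ ^ 2 := by
  have hM := h.nonneg
  have hint : Integrable (fun x => δ⁻¹ ^ 2 / 2 * (u ⬝ᵥ x) ^ 4 + δ ^ 2 / 2 * (w ⬝ᵥ x) ^ 4) P :=
    ((h.integrable u).const_mul _).add ((h.integrable w).const_mul _)
  have hpt : ∀ x : Fin d → ℝ, ((u ⬝ᵥ x) * (w ⬝ᵥ x)) ^ 2 ≤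
      δ⁻¹ ^ 2 / 2 * (u ⬝ᵥ x) ^ 4 + δ ^ 2 / 2 * (w ⬝ᵥ x) ^ 4 := by
    intro x
    have h1 : δ⁻¹ ^ 2 / 2 * (u ⬝ᵥ x) ^ 4 + δ ^ 2 / 2 * (w ⬝ᵥ x) ^ 4 -
      ((u ⬝ᵥ x) * (w ⬝ᵥ x)) ^ 2 = (δ⁻¹ * (u ⬝ᵥ x) ^ 2 - δ * (w ⬝ᵥ x) ^ 2) ^ 2 / 2 := by
      field_simp; ring
    have h2 : 0 ≤ (δ⁻¹ * (u ⬝ᵥ x) ^ 2 - δ * (w ⬝ᵥ x) ^ 2) ^ 2 / 2 := by positivity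
    linarith
  refine ⟨hint.mono' (((continuous_dotProduct_right u).mul
    (continuous_dotProduct_right w)).pow 2).aestronglyMeasurable (ae_of_all _ fun x => ?_), ?_⟩
  · rw [Real.norm_eq_abs, abs_of_nonneg (by positivity)]
    exact hpt x
  · refine (integral_mono_of_nonneg (ae_of_all _ fun x => sq_nonneg _) hint
      (ae_of_all _ hpt)).trans ?_
    rw [integral_add ((h.integrable u).const_mul _) ((h.integrable w).const_mul _),
      integral_const_mul, integral_const_mul]
    have h1 : ∫ x, (u ⬝ᵥ x) ^ 4 ∂P ≤ M * 1 ^ 2 := (h.le u).trans (by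
      gcongr; exact dotProduct_self_nonneg' u)
    have h2 : ∫ x, (w ⬝ᵥ x) ^ 4 ∂P ≤ M * (δ⁻¹ ^ 2) ^ 2 := (h.le w).trans (by
      gcongr; exact dotProduct_self_nonneg' w)
    calc _ ≤ δ⁻¹ ^ 2 / 2 * (M * 1 ^ 2) + δ ^ 2 / 2 * (M * (δ⁻¹ ^ 2) ^ 2) := by gcongr
      _ = _ := by field_simp; ring

/-- The weight `(1 + tr (Σ A) / N)⁻¹`, where `Σ` is the covariance matrix of `P`. -/
noncomputable def traceWeight (P : Measure (Fin d → ℝ)) (N : ℝ) (A : Matrix (Fin d) (Fin d) ℝ) :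
    ℝ :=
  (1 + N⁻¹ * (covMatrix P * A).trace)⁻¹

variable {P : Measure (Fin d → ℝ)} [IsProbabilityMeasure P] {M δ N s : ℝ}
  {B : Matrix (Fin d) (Fin d) ℝ}

theorem trace_covMatrix_mul_inv_nonneg (h : FourthMomentBound P M)
    (hmean : ∀ i, ∫ v, v i ∂P = 0) (hδ : 0 < δ) (hB : SymmCoercive δ B) :
    0 ≤ (covMatrix P * B⁻¹).trace := by
  rw [trace_covMatrix_mul h hmean]
  exact integral_nonneg fun x => hB.quadForm_inv_nonneg hδ x

theorem traceWeight_nonneg (h : FourthMomentBound P M) (hmean : ∀ i, ∫ v, v i ∂P = 0)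
    (hδ : 0 < δ) (hN : 0 < N) (hB : SymmCoercive δ B) : 0 ≤ traceWeight P N B⁻¹ := by
  have := trace_covMatrix_mul_inv_nonneg h hmean hδ hB
  unfold traceWeight; positivity

theorem traceWeight_le_one (h : FourthMomentBound P M) (hmean : ∀ i, ∫ v, v i ∂P = 0)
    (hδ : 0 < δ) (hN : 0 < N) (hB : SymmCoercive δ B) : traceWeight P N B⁻¹ ≤ 1 := by
  have := trace_covMatrix_mul_inv_nonneg h hmean hδ hB
  exact inv_le_one_of_one_le₀ (le_add_of_nonneg_right (by positivity))

/-- By Sherman–Morrison the trace changes by a multiple of wᵀΣw with w = B⁻¹x. Coercivity gives |w|²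
≤ δ⁻¹q, and the denominator 1 + q/N absorbs q, so the bound is uniform in x. -/
theorem abs_traceWeight_sub_le (h : FourthMomentBound P M) (hmean : ∀ i, ∫ v, v i ∂P = 0)
    (hδ : 0 < δ) (hN : 0 < N) (hB : SymmCoercive δ B) (x : Fin d → ℝ) :
    |traceWeight P N B⁻¹ - traceWeight P N (B + N⁻¹ • Matrix.vecMulVec x x)⁻¹| ≤
      N⁻¹ * ((1 + M) * δ⁻¹) := by
  have hM := h.nonneg
  have hN' : 0 ≤ N⁻¹ := (inv_pos.2 hN).le
  have h1 := trace_covMatrix_mul_inv_nonneg h hmean hδ hB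
  have h2 := trace_covMatrix_mul_inv_nonneg h hmean hδ (hB.add_vecMulVec hN' x)
  refine (abs_inv_one_add_sub_le (by positivity) (by positivity)).trans ?_
  rw [← mul_sub, abs_mul, abs_of_nonneg hN']
  gcongr
  rw [← Matrix.trace_sub, ← Matrix.mul_sub, hB.inv_add_vecMulVec hδ hN', sub_sub_cancel,
    Matrix.mul_smul, Matrix.mul_vecMulVec, Matrix.trace_smul, Matrix.trace_vecMulVec, smul_eq_mul]
  set w := B⁻¹ *ᵥ x with hw
  set q := x ⬝ᵥ w with hq
  have hq0 : 0 ≤ q := hB.quadForm_inv_nonneg hδ x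
  have hw1 : w ⬝ᵥ w ≤ δ⁻¹ * q := by
    rw [← div_eq_inv_mul, le_div_iff₀' hδ]; exact hB.mul_inv_mulVec_self_le hδ x
  have hc : N⁻¹ * (1 + N⁻¹ * q)⁻¹ * q ≤ 1 := by
    rw [mul_right_comm, ← div_eq_mul_inv, div_le_one (by positivity)]; linarith
  rw [dotProduct_comm, abs_mul, abs_of_nonneg (by positivity)]
  calc _ ≤ N⁻¹ * (1 + N⁻¹ * q)⁻¹ * (specNorm (covMatrix P) * (w ⬝ᵥ w)) := by
        gcongr; exact abs_quadForm_le_specNorm _ _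
    _ ≤ N⁻¹ * (1 + N⁻¹ * q)⁻¹ * ((1 + M) * (δ⁻¹ * q)) := by
        gcongr
        · exact dotProduct_self_nonneg' w
        · exact specNorm_covMatrix_le h hmean
    _ = (1 + M) * δ⁻¹ * (N⁻¹ * (1 + N⁻¹ * q)⁻¹ * q) := by ring
    _ ≤ (1 + M) * δ⁻¹ * 1 := by gcongr
    _ = _ := mul_one _

theorem abs_loo_sub_traceWeight_le (h : FourthMomentBound P M) (hmean : ∀ i, ∫ v, v i ∂P = 0)
    (hδ : 0 < δ) (hN : 0 < N) (hB : SymmCoercive δ B) (x : Fin d → ℝ) :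
    |(1 + N⁻¹ * (x ⬝ᵥ B⁻¹ *ᵥ x))⁻¹ - traceWeight P N B⁻¹| ≤
      |N⁻¹ * (x ⬝ᵥ B⁻¹ *ᵥ x) - N⁻¹ * (covMatrix P * B⁻¹).trace| := by
  have hN' : 0 ≤ N⁻¹ := (inv_pos.2 hN).le
  exact abs_inv_one_add_sub_le (mul_nonneg hN' (hB.quadForm_inv_nonneg hδ x))
    (mul_nonneg hN' (trace_covMatrix_mul_inv_nonneg h hmean hδ hB))

/-- Expresses the leave-one-out factor through the full resolvent, so that it can be averaged over
all observations. -/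
theorem one_sub_quadForm_inv_add_vecMulVec (hδ : 0 < δ) (hN : 0 < N) (hB : SymmCoercive δ B)
    (x : Fin d → ℝ) :
    1 - N⁻¹ * (x ⬝ᵥ (B + N⁻¹ • Matrix.vecMulVec x x)⁻¹ *ᵥ x) =
      (1 + N⁻¹ * (x ⬝ᵥ B⁻¹ *ᵥ x))⁻¹ := by
  have hN' : 0 ≤ N⁻¹ := (inv_pos.2 hN).le
  have hq := hB.quadForm_inv_nonneg hδ x
  rw [hB.inv_add_vecMulVec_mulVec_self hδ hN']
  have : 1 + N⁻¹ * (x ⬝ᵥ B⁻¹ *ᵥ x) ≠ 0 := by positivity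
  field_simp
  ring

theorem integrable_quadForm_sub_sq (h : FourthMomentBound P M) (A : Matrix (Fin d) (Fin d) ℝ)
    (c t : ℝ) : Integrable (fun x => (c * (x ⬝ᵥ A *ᵥ x) - t) ^ 2) P :=
  (((h.memLp_quadForm A).const_mul c).sub (memLp_const t)).integrable_sq

/-- The weight of one observation in the resolvent is close, in mean, to the trace weight. -/
theorem integral_abs_weight_sub_le (h : FourthMomentBound P M) (hmean : ∀ i, ∫ v, v i ∂P = 0)
    (hs : 0 < s) (hvar : quadVariance P ≤ ENNReal.ofReal (s ^ 2)) (hd : 0 < d) (hdN : d ≤ N)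
    (hδ : 0 < δ) (hB : SymmCoercive δ B) :
    ∫ x, |1 - N⁻¹ * (x ⬝ᵥ (B + N⁻¹ • Matrix.vecMulVec x x)⁻¹ *ᵥ x) -
      traceWeight P N (B + N⁻¹ • Matrix.vecMulVec x x)⁻¹| ∂P ≤
      s * (1 + δ⁻¹ ^ 2) / 2 + N⁻¹ * ((1 + M) * δ⁻¹) := by
  have hN : 0 < N := lt_of_lt_of_le (by exact_mod_cast hd) hdN
  set t := N⁻¹ * (covMatrix P * B⁻¹).trace
  have hint := integrable_quadForm_sub_sq h B⁻¹ N⁻¹ t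
  have hv := integral_quadForm_sub_trace_sq_le h hmean hvar hd hdN (hB.specNorm_inv_le hδ)
  have hpt : ∀ x : Fin d → ℝ, |1 - N⁻¹ * (x ⬝ᵥ (B + N⁻¹ • Matrix.vecMulVec x x)⁻¹ *ᵥ x) -
      traceWeight P N (B + N⁻¹ • Matrix.vecMulVec x x)⁻¹| ≤
      s⁻¹ / 2 * (N⁻¹ * (x ⬝ᵥ B⁻¹ *ᵥ x) - t) ^ 2 + (s / 2 + N⁻¹ * ((1 + M) * δ⁻¹)) := by
    intro x
    rw [one_sub_quadForm_inv_add_vecMulVec hδ hN hB]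
    have h1 := abs_loo_sub_traceWeight_le h hmean hδ hN hB x
    have h2 := abs_traceWeight_sub_le h hmean hδ hN hB x
    have h3 := abs_le_half_add_sq hs 1 (N⁻¹ * (x ⬝ᵥ B⁻¹ *ᵥ x) - t)
    have h4 := abs_sub_le (1 + N⁻¹ * (x ⬝ᵥ B⁻¹ *ᵥ x))⁻¹ (traceWeight P N B⁻¹)
      (traceWeight P N (B + N⁻¹ • Matrix.vecMulVec x x)⁻¹)
    rw [abs_one, one_mul] at h3
    linarith
  refine (integral_mono_of_nonneg (ae_of_all _ fun x => abs_nonneg _)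
    ((hint.const_mul _).add (integrable_const _)) (ae_of_all _ hpt)).trans ?_
  rw [integral_add' (hint.const_mul _) (integrable_const _), integral_const_mul]
  simp only [integral_const, probReal_univ, one_smul]
  have h5 : s⁻¹ / 2 * ∫ x, (N⁻¹ * (x ⬝ᵥ B⁻¹ *ᵥ x) - t) ^ 2 ∂P ≤ s⁻¹ / 2 * (s ^ 2 * δ⁻¹ ^ 2) := by
    gcongr
  have h6 : s⁻¹ / 2 * (s ^ 2 * δ⁻¹ ^ 2) = s / 2 * δ⁻¹ ^ 2 := by field_simp
  linarith

/-- Error bound in the one-observation form of the deterministic equivalent. -/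
noncomputable def bilinError (M δ N s : ℝ) : ℝ :=
  s * (M + 1) * δ⁻¹ ^ 2 / 2 + N⁻¹ * ((1 + M) ^ 2 * δ⁻¹ ^ 2) +
    N⁻¹ * ((1 + M) * ((1 + M) ^ 2 + 1) * δ⁻¹ ^ 2 / 2)

/-- If the factor (1+q)⁻¹ and the trace weight are both frozen at their value β for B, and ΣRv is
replaced by ΣB⁻¹v, the difference has mean exactly zero because B does not depend on x. It remains
to bound in mean the cost of these replacements. -/
theorem abs_integral_bilin_sub_le (h : FourthMomentBound P M) (hmean : ∀ i, ∫ v, v i ∂P = 0)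
    (hs : 0 < s) (hvar : quadVariance P ≤ ENNReal.ofReal (s ^ 2)) (hd : 0 < d) (hdN : d ≤ N)
    (hδ : 0 < δ) (hB : SymmCoercive δ B) {u v : Fin d → ℝ} (hu : u ⬝ᵥ u ≤ 1) (hv : v ⬝ᵥ v ≤ 1)
    (hint : Integrable (fun x => (u ⬝ᵥ x) * (x ⬝ᵥ (B + N⁻¹ • Matrix.vecMulVec x x)⁻¹ *ᵥ v) -
      (u ⬝ᵥ covMatrix P *ᵥ (B + N⁻¹ • Matrix.vecMulVec x x)⁻¹ *ᵥ v) *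
        traceWeight P N (B + N⁻¹ • Matrix.vecMulVec x x)⁻¹) P) :
    |∫ x, ((u ⬝ᵥ x) * (x ⬝ᵥ (B + N⁻¹ • Matrix.vecMulVec x x)⁻¹ *ᵥ v) -
      (u ⬝ᵥ covMatrix P *ᵥ (B + N⁻¹ • Matrix.vecMulVec x x)⁻¹ *ᵥ v) *
        traceWeight P N (B + N⁻¹ • Matrix.vecMulVec x x)⁻¹) ∂P| ≤ bilinError M δ N s := by
  have hM := h.nonneg
  have hN : 0 < N := lt_of_lt_of_le (by exact_mod_cast hd) hdN
  have hN' : 0 ≤ N⁻¹ := (inv_pos.2 hN).le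
  set t := N⁻¹ * (covMatrix P * B⁻¹).trace
  set β := traceWeight P N B⁻¹ with hβ
  set b := B⁻¹ *ᵥ v with hb
  set a := B⁻¹ *ᵥ covMatrix P *ᵥ u with ha
  have hb1 : b ⬝ᵥ b ≤ δ⁻¹ ^ 2 := hB.inv_mulVec_self_le_of_le_one hδ hv
  have hTu := covMatrix_mulVec_self_le h hmean hu
  have ha1 : a ⬝ᵥ a ≤ δ⁻¹ ^ 2 * (1 + M) ^ 2 :=
    (hB.inv_mulVec_self_le hδ _).trans (by gcongr)
  have hm : |u ⬝ᵥ covMatrix P *ᵥ b| ≤ (1 + M) * δ⁻¹ := by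
    rw [(covMatrix_isSymm P).dotProduct_mulVec_comm]
    exact abs_dotProduct_le (by positivity) (by positivity) hTu hb1
  have hqint := integrable_quadForm_sub_sq h B⁻¹ N⁻¹ t
  have hqv := integral_quadForm_sub_trace_sq_le h hmean hvar hd hdN (hB.specNorm_inv_le hδ)
  obtain ⟨hpint, hpv⟩ := h.integral_mul_sq_le hδ hu hb1
  have hzero : ∫ x, (β * ((u ⬝ᵥ x) * (b ⬝ᵥ x)) - β * (u ⬝ᵥ covMatrix P *ᵥ b)) ∂P = 0 := by
    rw [integral_sub ((h.integrable_mul u b).const_mul _) (integrable_const _), integral_const_mul,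
      dotProduct_covMatrix_mulVec h hmean]
    simp
  have hzint : Integrable (fun x => β * ((u ⬝ᵥ x) * (b ⬝ᵥ x)) - β * (u ⬝ᵥ covMatrix P *ᵥ b)) P :=
    ((h.integrable_mul u b).const_mul _).sub (integrable_const _)
  have hpt : ∀ x : Fin d → ℝ,
      |(u ⬝ᵥ x) * (x ⬝ᵥ (B + N⁻¹ • Matrix.vecMulVec x x)⁻¹ *ᵥ v) -
        (u ⬝ᵥ covMatrix P *ᵥ (B + N⁻¹ • Matrix.vecMulVec x x)⁻¹ *ᵥ v) *
          traceWeight P N (B + N⁻¹ • Matrix.vecMulVec x x)⁻¹ -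
        (β * ((u ⬝ᵥ x) * (b ⬝ᵥ x)) - β * (u ⬝ᵥ covMatrix P *ᵥ b))| ≤
      s / 2 * ((u ⬝ᵥ x) * (b ⬝ᵥ x)) ^ 2 + s⁻¹ / 2 * (N⁻¹ * (x ⬝ᵥ B⁻¹ *ᵥ x) - t) ^ 2 +
        N⁻¹ * |(a ⬝ᵥ x) * (b ⬝ᵥ x)| + (1 + M) * δ⁻¹ * (N⁻¹ * ((1 + M) * δ⁻¹)) := by
    intro x
    have hq := hB.quadForm_inv_nonneg hδ x
    have h1 := abs_loo_sub_traceWeight_le h hmean hδ hN hB x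
    have h2 := abs_traceWeight_sub_le h hmean hδ hN hB x
    have h3 := traceWeight_nonneg h hmean hδ hN (hB.add_vecMulVec hN' x)
    have h4 := traceWeight_le_one h hmean hδ hN (hB.add_vecMulVec hN' x)
    rw [hB.inv_add_vecMulVec_mulVec_self hδ hN', hB.inv_add_vecMulVec_mulVec hδ hN' x v]
    set β' := traceWeight P N (B + N⁻¹ • Matrix.vecMulVec x x)⁻¹
    have h5 : x ⬝ᵥ B⁻¹ *ᵥ v = b ⬝ᵥ x := dotProduct_comm _ _
    have h6 : u ⬝ᵥ covMatrix P *ᵥ B⁻¹ *ᵥ x = a ⬝ᵥ x := by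
      rw [(covMatrix_isSymm P).dotProduct_mulVec_comm, hB.inv_isSymm.dotProduct_mulVec_comm]
    set q := N⁻¹ * (x ⬝ᵥ B⁻¹ *ᵥ x) with hqd
    have hq0 : 0 ≤ q := by positivity
    set γ := (1 + q)⁻¹ with hγ
    have hγ0 : 0 ≤ γ := by positivity
    have hγ1 : γ ≤ 1 := inv_le_one_of_one_le₀ (by linarith)
    rw [h5, Matrix.mulVec_sub, Matrix.mulVec_smul, dotProduct_sub, dotProduct_smul, h6, smul_eq_mul]
    set m := u ⬝ᵥ covMatrix P *ᵥ b
    -- Three errors: fluctuation of q about its trace, change of the trace weight when x is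
    -- restored, and the rank-one correction inside ΣRv.
    have hsplit : (u ⬝ᵥ x) * (γ * (b ⬝ᵥ x)) - (m - N⁻¹ * γ * (b ⬝ᵥ x) * (a ⬝ᵥ x)) * β' -
        (β * ((u ⬝ᵥ x) * (b ⬝ᵥ x)) - β * m) =
        (u ⬝ᵥ x) * (b ⬝ᵥ x) * (γ - β) + m * (β - β') +
          N⁻¹ * ((γ * β') * ((a ⬝ᵥ x) * (b ⬝ᵥ x))) := by ring
    rw [hsplit]
    refine (abs_add_three _ _ _).trans ?_
    -- The weight s in the arithmetic–geometric inequality balances a bounded second moment against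
    -- one of order s², so both parts are of order s.
    have e1 : |(u ⬝ᵥ x) * (b ⬝ᵥ x) * (γ - β)| ≤
        s / 2 * ((u ⬝ᵥ x) * (b ⬝ᵥ x)) ^ 2 + s⁻¹ / 2 * (q - t) ^ 2 := by
      rw [abs_mul]
      exact (mul_le_mul_of_nonneg_left h1 (abs_nonneg _)).trans (abs_le_half_add_sq hs _ _)
    have e2 : |m * (β - β')| ≤ (1 + M) * δ⁻¹ * (N⁻¹ * ((1 + M) * δ⁻¹)) := by
      rw [abs_mul]
      exact mul_le_mul hm h2 (abs_nonneg _) (by positivity)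
    have e3 : |N⁻¹ * ((γ * β') * ((a ⬝ᵥ x) * (b ⬝ᵥ x)))| ≤ N⁻¹ * |(a ⬝ᵥ x) * (b ⬝ᵥ x)| := by
      rw [abs_mul, abs_of_nonneg hN', abs_mul (γ * β'), abs_of_nonneg (mul_nonneg hγ0 h3)]
      gcongr
      exact mul_le_of_le_one_left (abs_nonneg _) (mul_le_one₀ hγ1 h3 h4)
    linarith
  have hI : Integrable (fun x : Fin d → ℝ =>
      s / 2 * ((u ⬝ᵥ x) * (b ⬝ᵥ x)) ^ 2 + s⁻¹ / 2 * (N⁻¹ * (x ⬝ᵥ B⁻¹ *ᵥ x) - t) ^ 2) P :=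
    (hpint.const_mul _).add (hqint.const_mul _)
  have hI' : Integrable (fun x : Fin d → ℝ =>
      s / 2 * ((u ⬝ᵥ x) * (b ⬝ᵥ x)) ^ 2 + s⁻¹ / 2 * (N⁻¹ * (x ⬝ᵥ B⁻¹ *ᵥ x) - t) ^ 2 +
        N⁻¹ * |(a ⬝ᵥ x) * (b ⬝ᵥ x)|) P :=
    hI.add ((h.integrable_mul a b).abs.const_mul _)
  have hsub := integral_sub hint hzint
  rw [hzero, sub_zero] at hsub
  rw [← hsub]
  refine (abs_integral_le_integral_abs).trans ?_
  refine (integral_mono_of_nonneg (ae_of_all _ fun x => abs_nonneg _)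
    (hI'.add (integrable_const _)) (ae_of_all _ hpt)).trans ?_
  rw [integral_add' hI' (integrable_const _), integral_add hI ((h.integrable_mul a b).abs.const_mul _),
    integral_add (hpint.const_mul _) (hqint.const_mul _), integral_const_mul, integral_const_mul,
    integral_const_mul]
  simp only [integral_const, probReal_univ, one_smul]
  have e1 : s / 2 * ∫ x, ((u ⬝ᵥ x) * (b ⬝ᵥ x)) ^ 2 ∂P ≤ s / 2 * (M * δ⁻¹ ^ 2) := by gcongr
  have e2 : s⁻¹ / 2 * ∫ x, (N⁻¹ * (x ⬝ᵥ B⁻¹ *ᵥ x) - t) ^ 2 ∂P ≤ s⁻¹ / 2 * (s ^ 2 * δ⁻¹ ^ 2) := by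
    gcongr
  have e3 : N⁻¹ * ∫ x, |(a ⬝ᵥ x) * (b ⬝ᵥ x)| ∂P ≤
      N⁻¹ * ((1 + M) * (δ⁻¹ ^ 2 * (1 + M) ^ 2 + δ⁻¹ ^ 2) / 2) := by
    gcongr
    refine (h.integral_abs_mul_le a b).trans ?_
    gcongr
  have e4 : s⁻¹ / 2 * (s ^ 2 * δ⁻¹ ^ 2) = s / 2 * δ⁻¹ ^ 2 := by field_simp
  rw [e4] at e2
  unfold bilinError
  linarith

end OneSample

/-! ### Ridge resolvents of the whole sample under the product law. -/

section ProductMeasure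

variable {n m d : ℕ}

/-- The matrix `N⁻¹ ∑ xⱼ xⱼᵀ + δ I`. -/
noncomputable def ridge (N δ : ℝ) (x : Fin m → Fin d → ℝ) : Matrix (Fin d) (Fin d) ℝ :=
  N⁻¹ • ∑ j, Matrix.vecMulVec (x j) (x j) + δ • (1 : Matrix (Fin d) (Fin d) ℝ)

theorem ridge_eq_empCov_add (δ : ℝ) (x : Fin n → Fin d → ℝ) :
    ridge n δ x = empCov x + δ • (1 : Matrix (Fin d) (Fin d) ℝ) := rfl

theorem smul_sum_vecMulVec_mulVec (N : ℝ) (x : Fin m → Fin d → ℝ) (v : Fin d → ℝ) :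
    (N⁻¹ • ∑ j, Matrix.vecMulVec (x j) (x j)) *ᵥ v = N⁻¹ • ∑ j, (x j ⬝ᵥ v) • x j := by
  rw [Matrix.smul_mulVec, Matrix.sum_mulVec]
  congr 1
  refine Finset.sum_congr rfl fun j _ => ?_
  rw [Matrix.vecMulVec_mulVec]
  ext i
  simp [mul_comm]

theorem dotProduct_smul_sum_vecMulVec_mulVec (N : ℝ) (x : Fin m → Fin d → ℝ) (u v : Fin d → ℝ) :
    u ⬝ᵥ (N⁻¹ • ∑ j, Matrix.vecMulVec (x j) (x j)) *ᵥ v =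
      N⁻¹ * ∑ j, (u ⬝ᵥ x j) * (x j ⬝ᵥ v) := by
  rw [smul_sum_vecMulVec_mulVec, dotProduct_smul, dotProduct_sum, smul_eq_mul]
  congr 1
  refine Finset.sum_congr rfl fun j _ => ?_
  rw [dotProduct_smul, smul_eq_mul, mul_comm]

theorem isSymm_smul_sum_vecMulVec (N : ℝ) (x : Fin m → Fin d → ℝ) :
    (N⁻¹ • ∑ j, Matrix.vecMulVec (x j) (x j)).IsSymm := by
  rw [Matrix.IsSymm, Matrix.transpose_smul, Matrix.transpose_sum]
  simp only [Matrix.transpose_vecMulVec]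

theorem SymmCoercive.add_smul_one {σ : ℝ} {A : Matrix (Fin d) (Fin d) ℝ} (hA : SymmCoercive σ A)
    (δ : ℝ) : SymmCoercive (σ + δ) (A + δ • (1 : Matrix (Fin d) (Fin d) ℝ)) := by
  refine ⟨hA.symm.add ((Matrix.isSymm_one).smul δ), fun v => ?_⟩
  rw [Matrix.add_mulVec, Matrix.smul_mulVec, Matrix.one_mulVec, dotProduct_add, dotProduct_smul,
    smul_eq_mul, add_mul]
  linarith [hA.le v]

theorem symmCoercive_ridge {N : ℝ} (hN : 0 ≤ N) (δ : ℝ) (x : Fin m → Fin d → ℝ) :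
    SymmCoercive δ (ridge N δ x) := by
  have h : SymmCoercive 0 (N⁻¹ • ∑ j, Matrix.vecMulVec (x j) (x j)) := by
    refine ⟨isSymm_smul_sum_vecMulVec N x, fun v => ?_⟩
    rw [dotProduct_smul_sum_vecMulVec_mulVec, zero_mul]
    refine mul_nonneg (inv_nonneg.2 hN) (Finset.sum_nonneg fun j _ => ?_)
    rw [dotProduct_comm]
    exact mul_self_nonneg _
  have := h.add_smul_one δ
  rwa [zero_add] at this

/-- The normalisation N is independent of the number m of summands so that deleting an observation
keeps the factor N⁻¹. -/
theorem ridge_insertNth (N δ : ℝ) (i : Fin (m + 1)) (y : Fin d → ℝ) (z : Fin m → Fin d → ℝ) :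
    ridge N δ (i.insertNth y z : Fin (m + 1) → Fin d → ℝ) =
      ridge N δ z + N⁻¹ • Matrix.vecMulVec y y := by
  simp only [ridge, Fin.sum_univ_succAbove _ i, Fin.insertNth_apply_same,
    Fin.insertNth_apply_succAbove, smul_add]
  abel

theorem continuous_ridge (N δ : ℝ) : Continuous fun x : Fin m → Fin d → ℝ => ridge N δ x := by
  unfold ridge
  refine ((continuous_finsetSum Finset.univ
    (f := fun j (x : Fin m → Fin d → ℝ) => Matrix.vecMulVec (x j) (x j)) fun j _ => ?_).const_smul N⁻¹).add
    continuous_const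
  exact (continuous_apply j).matrix_vecMulVec (continuous_apply j)

theorem continuous_ridge_inv {N δ : ℝ} (hN : 0 ≤ N) (hδ : 0 < δ) :
    Continuous fun x : Fin m → Fin d → ℝ => (ridge N δ x)⁻¹ :=
  continuous_inv_of_symmCoercive (continuous_ridge N δ) hδ (symmCoercive_ridge hN δ)

theorem continuous_bilin_ridge_inv {N δ : ℝ} (hN : 0 ≤ N) (hδ : 0 < δ) (u v : Fin d → ℝ) :
    Continuous fun x : Fin m → Fin d → ℝ => u ⬝ᵥ (ridge N δ x)⁻¹ *ᵥ v :=
  continuous_const.dotProduct ((continuous_ridge_inv hN hδ).matrix_mulVec continuous_const)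

/-- The empirical part of a ridge matrix paired with its inverse. -/
theorem sum_bilin_ridge_inv {N δ : ℝ} (hN : 0 ≤ N) (hδ : 0 < δ) (x : Fin m → Fin d → ℝ)
    (u v : Fin d → ℝ) :
    N⁻¹ * ∑ j, (u ⬝ᵥ x j) * (x j ⬝ᵥ (ridge N δ x)⁻¹ *ᵥ v) =
      u ⬝ᵥ v - δ * (u ⬝ᵥ (ridge N δ x)⁻¹ *ᵥ v) := by
  rw [← dotProduct_smul_sum_vecMulVec_mulVec]
  have h := (symmCoercive_ridge hN δ x).mulVec_inv_mulVec hδ v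
  have h1 : u ⬝ᵥ ridge N δ x *ᵥ (ridge N δ x)⁻¹ *ᵥ v = u ⬝ᵥ v := by rw [h]
  conv at h1 => lhs; rhs; lhs; rw [ridge]
  rw [Matrix.add_mulVec, Matrix.smul_mulVec _ (1 : Matrix (Fin d) (Fin d) ℝ), Matrix.one_mulVec,
    dotProduct_add, dotProduct_smul, smul_eq_mul] at h1
  linarith

/-- Trace of R R⁻¹ = I. This is where the dimension d, and later the ratio d/n, appears. -/
theorem sum_quadForm_ridge_inv {N δ : ℝ} (hN : 0 ≤ N) (hδ : 0 < δ) (x : Fin m → Fin d → ℝ) :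
    N⁻¹ * ∑ j, x j ⬝ᵥ (ridge N δ x)⁻¹ *ᵥ x j = d - δ * ((ridge N δ x)⁻¹).trace := by
  have h : ((ridge N δ x)⁻¹ * ridge N δ x).trace = d := by
    rw [Matrix.nonsing_inv_mul _ ((symmCoercive_ridge hN δ x).isUnit_det hδ)]
    simp
  conv at h => lhs; arg 1; rhs; rw [ridge]
  rw [Matrix.mul_add, Matrix.mul_smul, Matrix.mul_smul, Matrix.mul_one, Matrix.mul_sum,
    Matrix.trace_add, Matrix.trace_smul, Matrix.trace_smul, Matrix.trace_sum, smul_eq_mul,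
    smul_eq_mul] at h
  simp only [Matrix.mul_vecMulVec, Matrix.trace_vecMulVec] at h
  rw [← h, add_sub_cancel_right]
  congr 1
  exact Finset.sum_congr rfl fun j _ => dotProduct_comm _ _

theorem sum_weight_ridge_inv {δ : ℝ} (hn : 0 < n) (hδ : 0 < δ) (x : Fin n → Fin d → ℝ) :
    (n : ℝ)⁻¹ * ∑ j, (1 - (n : ℝ)⁻¹ * (x j ⬝ᵥ (ridge n δ x)⁻¹ *ᵥ x j)) =
      1 - d / n + δ * ((n : ℝ)⁻¹ * ((ridge n δ x)⁻¹).trace) := by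
  have hn' : (n : ℝ) ≠ 0 := by exact_mod_cast hn.ne'
  rw [Finset.sum_sub_distrib, ← Finset.mul_sum, sum_quadForm_ridge_inv n.cast_nonneg hδ]
  simp
  field_simp
  ring

theorem continuous_bilin_covMatrix_mul_ridge_inv (P : Measure (Fin d → ℝ)) {N δ : ℝ} (hN : 0 ≤ N) (hδ : 0 < δ)
    (u v : Fin d → ℝ) :
    Continuous fun x : Fin m → Fin d → ℝ => u ⬝ᵥ covMatrix P *ᵥ (ridge N δ x)⁻¹ *ᵥ v :=
  continuous_const.dotProduct (continuous_const.matrix_mulVec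
    ((continuous_ridge_inv hN hδ).matrix_mulVec continuous_const))

variable {P : Measure (Fin d → ℝ)} [IsProbabilityMeasure P]

/-- Fubini with one coordinate singled out. Only almost every slice is integrable, so the slice
bound may assume integrability. -/
theorem abs_integral_pi_le (i : Fin (m + 1)) {g : (Fin (m + 1) → Fin d → ℝ) → ℝ}
    (hg : Integrable g (Measure.pi fun _ => P)) {c : ℝ}
    (h : ∀ z : Fin m → Fin d → ℝ, Integrable (fun y => g (i.insertNth y z)) P →
      |∫ y, g (i.insertNth y z) ∂P| ≤ c) :
    |∫ x, g x ∂(Measure.pi fun _ => P)| ≤ c := by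
  have hmp := (measurePreserving_piFinSuccAbove (fun _ : Fin (m + 1) => P) i).symm
  have hg' := (hmp.integrable_comp_emb (MeasurableEquiv.measurableEmbedding _)).2 hg
  rw [← hmp.integral_comp']
  refine (congrArg abs (integral_prod_symm _ hg')).trans_le ?_
  refine norm_integral_le_of_norm_le_const (μ := Measure.pi fun _ : Fin m => P) (C := c)
    (f := fun z => ∫ y, g (i.insertNth y z) ∂P) ?_ |>.trans (by simp)
  filter_upwards [hg'.prod_left_ae] with z hz
  exact h z hz

variable {M δ s : ℝ}

theorem integrable_pi_of_bounded {g : (Fin n → Fin d → ℝ) → ℝ} (hg : Continuous g) {c : ℝ}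
    (h : ∀ x, |g x| ≤ c) : Integrable g (Measure.pi fun _ => P) :=
  Integrable.of_bound hg.aestronglyMeasurable c (ae_of_all _ h)

theorem continuous_traceWeight_ridge_inv (h : FourthMomentBound P M)
    (hmean : ∀ i, ∫ v, v i ∂P = 0) (hn : 0 < n) (hδ : 0 < δ) :
    Continuous fun x : Fin n → Fin d → ℝ => traceWeight P n (ridge n δ x)⁻¹ := by
  have hn' : (0 : ℝ) < n := by exact_mod_cast hn
  refine Continuous.inv₀ ?_ fun x => ?_
  · exact continuous_const.add (continuous_const.mul
      (continuous_const.matrix_mul (continuous_ridge_inv hn'.le hδ)).matrix_trace)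
  · have := trace_covMatrix_mul_inv_nonneg h hmean hδ (symmCoercive_ridge hn'.le δ x)
    positivity

theorem abs_bilin_covMatrix_mul_inv_le (h : FourthMomentBound P M) (hmean : ∀ i, ∫ v, v i ∂P = 0)
    {B : Matrix (Fin d) (Fin d) ℝ} (hδ : 0 < δ) (hB : SymmCoercive δ B) {u v : Fin d → ℝ}
    (hu : u ⬝ᵥ u ≤ 1) (hv : v ⬝ᵥ v ≤ 1) : |u ⬝ᵥ covMatrix P *ᵥ B⁻¹ *ᵥ v| ≤ (1 + M) * δ⁻¹ := by
  have hM := h.nonneg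
  rw [(covMatrix_isSymm P).dotProduct_mulVec_comm]
  exact abs_dotProduct_le (by positivity) (by positivity) (covMatrix_mulVec_self_le h hmean hu)
    (hB.inv_mulVec_self_le_of_le_one hδ hv)

theorem integrable_bilin_sub (h : FourthMomentBound P M) (hmean : ∀ i, ∫ v, v i ∂P = 0)
    (hn : 0 < n) (hδ : 0 < δ) {u v : Fin d → ℝ} (hu : u ⬝ᵥ u ≤ 1) (hv : v ⬝ᵥ v ≤ 1) (i : Fin n) :
    Integrable (fun x : Fin n → Fin d → ℝ => (u ⬝ᵥ x i) * (x i ⬝ᵥ (ridge n δ x)⁻¹ *ᵥ v) -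
      (u ⬝ᵥ covMatrix P *ᵥ (ridge n δ x)⁻¹ *ᵥ v) * traceWeight P n (ridge n δ x)⁻¹)
      (Measure.pi fun _ => P) := by
  have hn' : (0 : ℝ) < n := by exact_mod_cast hn
  have hcR := continuous_ridge_inv (m := n) (d := d) hn'.le hδ
  have hM := h.nonneg
  refine Integrable.sub ?_ ?_
  -- This term is unbounded in the observation; it is dominated by δ⁻¹|xᵢ|².
  · have h1 : Integrable (fun x : Fin n → Fin d → ℝ => δ⁻¹ * (x i ⬝ᵥ x i))
        (Measure.pi fun _ => P) := by
      refine Integrable.const_mul ?_ _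
      have := h.integrable_quadForm 1
      simp only [Matrix.one_mulVec] at this
      exact (measurePreserving_eval (fun _ : Fin n => P) i).integrable_comp_of_integrable this
    refine h1.mono' (Continuous.aestronglyMeasurable ?_) (ae_of_all _ fun x => ?_)
    · exact (continuous_const.dotProduct (continuous_apply i)).mul
        ((continuous_apply i).dotProduct (hcR.matrix_mulVec continuous_const))
    · have hx := dotProduct_self_nonneg' (x i)
      have hsq := Real.sq_sqrt hx
      have e1 := abs_dotProduct_le zero_le_one (Real.sqrt_nonneg (x i ⬝ᵥ x i))
        (hu.trans (by norm_num)) hsq.ge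
      have e2 := abs_dotProduct_le (Real.sqrt_nonneg (x i ⬝ᵥ x i)) (inv_nonneg.2 hδ.le) hsq.ge
        ((symmCoercive_ridge hn'.le δ x).inv_mulVec_self_le_of_le_one hδ hv)
      rw [Real.norm_eq_abs, abs_mul]
      calc _ ≤ 1 * √(x i ⬝ᵥ x i) * (√(x i ⬝ᵥ x i) * δ⁻¹) := by gcongr
        _ = δ⁻¹ * √(x i ⬝ᵥ x i) ^ 2 := by ring
        _ = _ := by rw [hsq]
  · refine integrable_pi_of_bounded ((continuous_bilin_covMatrix_mul_ridge_inv P hn'.le hδ u v).mul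
      (continuous_traceWeight_ridge_inv h hmean hn hδ)) (c := (1 + M) * δ⁻¹) fun x => ?_
    have hR := symmCoercive_ridge hn'.le δ x
    rw [abs_mul, abs_of_nonneg (traceWeight_nonneg h hmean hδ hn' hR)]
    exact (mul_le_of_le_one_right (abs_nonneg _) (traceWeight_le_one h hmean hδ hn' hR)).trans
      (abs_bilin_covMatrix_mul_inv_le h hmean hδ hR hu hv)

theorem abs_integral_pi_bilin_sub_le (h : FourthMomentBound P M) (hmean : ∀ i, ∫ v, v i ∂P = 0)
    (hs : 0 < s) (hvar : quadVariance P ≤ ENNReal.ofReal (s ^ 2)) (hd : 0 < d) (hdn : d ≤ n)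
    (hδ : 0 < δ) {u v : Fin d → ℝ} (hu : u ⬝ᵥ u ≤ 1) (hv : v ⬝ᵥ v ≤ 1) (i : Fin n) :
    |∫ x : Fin n → Fin d → ℝ, ((u ⬝ᵥ x i) * (x i ⬝ᵥ (ridge n δ x)⁻¹ *ᵥ v) -
      (u ⬝ᵥ covMatrix P *ᵥ (ridge n δ x)⁻¹ *ᵥ v) * traceWeight P n (ridge n δ x)⁻¹)
      ∂(Measure.pi fun _ => P)| ≤ bilinError M δ n s := by
  obtain ⟨m, rfl⟩ := Nat.exists_eq_succ_of_ne_zero (hd.trans_le hdn).ne'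
  refine abs_integral_pi_le i (integrable_bilin_sub h hmean (hd.trans_le hdn) hδ hu hv i)
    fun z hz => ?_
  simp only [ridge_insertNth, Fin.insertNth_apply_same] at hz ⊢
  exact abs_integral_bilin_sub_le h hmean hs hvar hd (by exact_mod_cast hdn) hδ
    (symmCoercive_ridge (Nat.cast_nonneg _) δ z) hu hv hz

/-- Error bound for the weights of the observations. -/
noncomputable def weightError (M δ N s : ℝ) : ℝ :=
  s * (1 + δ⁻¹ ^ 2) / 2 + N⁻¹ * ((1 + M) * δ⁻¹)

theorem integrable_weight_sub (h : FourthMomentBound P M) (hmean : ∀ i, ∫ v, v i ∂P = 0)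
    (hn : 0 < n) (hδ : 0 < δ) (i : Fin n) :
    Integrable (fun x : Fin n → Fin d → ℝ => |1 - (n : ℝ)⁻¹ * (x i ⬝ᵥ (ridge n δ x)⁻¹ *ᵥ x i) -
      traceWeight P n (ridge n δ x)⁻¹|) (Measure.pi fun _ => P) := by
  have hn' : (0 : ℝ) < n := by exact_mod_cast hn
  have hcR := continuous_ridge_inv (m := n) (d := d) hn'.le hδ
  have hM := h.nonneg
  refine integrable_pi_of_bounded (c := 1) ?_ fun x => ?_
  · exact ((continuous_const.sub (continuous_const.mul ((continuous_apply i).dotProduct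
      (hcR.matrix_mulVec (continuous_apply i))))).sub
        (continuous_traceWeight_ridge_inv h hmean hn hδ)).abs
  · have hR := symmCoercive_ridge hn'.le δ x
    have h1 := traceWeight_nonneg h hmean hδ hn' hR
    have h2 := traceWeight_le_one h hmean hδ hn' hR
    have h3 : 0 ≤ (n : ℝ)⁻¹ * (x i ⬝ᵥ (ridge n δ x)⁻¹ *ᵥ x i) :=
      mul_nonneg (inv_nonneg.2 hn'.le) (hR.quadForm_inv_nonneg hδ _)
    -- By the leave-one-out identity one minus this quantity is the inverse of a positive number.
    have h4 : (n : ℝ)⁻¹ * (x i ⬝ᵥ (ridge n δ x)⁻¹ *ᵥ x i) ≤ 1 := by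
      obtain ⟨m, rfl⟩ := Nat.exists_eq_succ_of_ne_zero hn.ne'
      have e1 : ridge (m.succ : ℕ) δ x = ridge (m.succ : ℕ) δ (i.removeNth x) +
          ((m.succ : ℕ) : ℝ)⁻¹ • Matrix.vecMulVec (x i) (x i) := by
        rw [← ridge_insertNth, Fin.insertNth_self_removeNth]
      have e2 := symmCoercive_ridge hn'.le δ (i.removeNth x)
      have e3 := one_sub_quadForm_inv_add_vecMulVec hδ hn' e2 (x i)
      rw [← e1] at e3
      have e4 := e2.quadForm_inv_nonneg hδ (x i)
      have e5 : 0 ≤ (1 + ((m.succ : ℕ) : ℝ)⁻¹ *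
        (x i ⬝ᵥ (ridge (m.succ : ℕ) δ (i.removeNth x))⁻¹ *ᵥ x i))⁻¹ := by positivity
      linarith
    rw [abs_abs]
    exact abs_le.2 ⟨by linarith, by linarith⟩

theorem integral_pi_abs_weight_sub_le (h : FourthMomentBound P M) (hmean : ∀ i, ∫ v, v i ∂P = 0)
    (hs : 0 < s) (hvar : quadVariance P ≤ ENNReal.ofReal (s ^ 2)) (hd : 0 < d) (hdn : d ≤ n)
    (hδ : 0 < δ) (i : Fin n) :
    ∫ x : Fin n → Fin d → ℝ, |1 - (n : ℝ)⁻¹ * (x i ⬝ᵥ (ridge n δ x)⁻¹ *ᵥ x i) -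
      traceWeight P n (ridge n δ x)⁻¹| ∂(Measure.pi fun _ => P) ≤ weightError M δ n s := by
  obtain ⟨m, rfl⟩ := Nat.exists_eq_succ_of_ne_zero (hd.trans_le hdn).ne'
  refine (le_abs_self _).trans (abs_integral_pi_le i
    (integrable_weight_sub h hmean (hd.trans_le hdn) hδ i) fun z hz => ?_)
  simp only [ridge_insertNth, Fin.insertNth_apply_same]
  rw [abs_of_nonneg (integral_nonneg fun _ => abs_nonneg _)]
  exact integral_abs_weight_sub_le h hmean hs hvar hd (by exact_mod_cast hdn) hδ
    (symmCoercive_ridge (Nat.cast_nonneg _) δ z)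

end ProductMeasure

/-! ### The deterministic equivalent and dependence on the ridge parameter. -/

section DeterministicEquivalent

variable {n d : ℕ}

/-- The samples whose empirical covariance is not bounded below by `σ`. -/
def illConditioned (n d : ℕ) (σ : ℝ) : Set (Fin n → Fin d → ℝ) :=
  {x | ¬ SymmCoercive σ (empCov x)}

theorem continuous_empCov : Continuous fun x : Fin n → Fin d → ℝ => empCov x := by
  have h := continuous_ridge (m := n) (d := d) n 0
  simpa [ridge_eq_empCov_add] using h

/-- The complement is an intersection of closed conditions, one for each vector. -/
theorem measurableSet_illConditioned (n d : ℕ) (σ : ℝ) :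
    MeasurableSet (illConditioned n d σ) := by
  have h : (illConditioned n d σ)ᶜ = ⋂ v : Fin d → ℝ,
      {x : Fin n → Fin d → ℝ | σ * (v ⬝ᵥ v) ≤ v ⬝ᵥ empCov x *ᵥ v} := by
    ext x
    simp only [illConditioned, Set.mem_compl_iff, Set.mem_ofPred_eq, not_not, Set.mem_iInter]
    exact ⟨fun h => h.le, fun h => ⟨isSymm_smul_sum_vecMulVec _ _, h⟩⟩
  have hc : IsClosed (illConditioned n d σ)ᶜ := by
    rw [h]
    exact isClosed_iInter fun v => isClosed_le continuous_const
      (continuous_const.dotProduct (continuous_empCov.matrix_mulVec continuous_const))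
  exact MeasurableSet.of_compl hc.measurableSet

theorem integral_le_add_mul_measureReal {α : Type*} [MeasurableSpace α] {Q : Measure α}
    [IsProbabilityMeasure Q] {S : Set α} (hS : MeasurableSet S) {f : α → ℝ} {a b : ℝ}
    (ha : 0 ≤ a) (hf : ∀ x, 0 ≤ f x) (hfa : ∀ x ∉ S, f x ≤ a) (hfb : ∀ x, f x ≤ b) :
    ∫ x, f x ∂Q ≤ a + b * Q.real S := by
  have hI : Integrable (S.indicator fun _ => b) Q := (integrable_const b).indicator hS
  refine (integral_mono_of_nonneg (ae_of_all _ hf) ((integrable_const a).add hI)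
    (ae_of_all _ fun x => ?_)).trans ?_
  · by_cases hx : x ∈ S
    · simpa [hx] using (hfb x).trans (le_add_of_nonneg_left ha)
    · simpa [hx] using hfa x hx
  · rw [integral_add' (integrable_const a) hI, integral_indicator_const _ hS]
    simp [mul_comm]

variable {P : Measure (Fin d → ℝ)} [IsProbabilityMeasure P] {M δ s : ℝ}

theorem abs_integral_sub_bilin_mul_traceWeight_le (h : FourthMomentBound P M)
    (hmean : ∀ i, ∫ v, v i ∂P = 0) (hs : 0 < s)
    (hvar : quadVariance P ≤ ENNReal.ofReal (s ^ 2)) (hd : 0 < d) (hdn : d ≤ n)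
    (hδ : 0 < δ) {u v : Fin d → ℝ} (hu : u ⬝ᵥ u ≤ 1) (hv : v ⬝ᵥ v ≤ 1) :
    |∫ x : Fin n → Fin d → ℝ, (u ⬝ᵥ v - δ * (u ⬝ᵥ (ridge n δ x)⁻¹ *ᵥ v) -
      (u ⬝ᵥ covMatrix P *ᵥ (ridge n δ x)⁻¹ *ᵥ v) * traceWeight P n (ridge n δ x)⁻¹)
      ∂(Measure.pi fun _ => P)| ≤ bilinError M δ n s := by
  have hn := hd.trans_le hdn
  have hn' : (0 : ℝ) < n := by exact_mod_cast hn
  have heq : ∀ x : Fin n → Fin d → ℝ, u ⬝ᵥ v - δ * (u ⬝ᵥ (ridge n δ x)⁻¹ *ᵥ v) -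
      (u ⬝ᵥ covMatrix P *ᵥ (ridge n δ x)⁻¹ *ᵥ v) * traceWeight P n (ridge n δ x)⁻¹ =
      (n : ℝ)⁻¹ * ∑ i, ((u ⬝ᵥ x i) * (x i ⬝ᵥ (ridge n δ x)⁻¹ *ᵥ v) -
      (u ⬝ᵥ covMatrix P *ᵥ (ridge n δ x)⁻¹ *ᵥ v) * traceWeight P n (ridge n δ x)⁻¹) := by
    intro x
    rw [Finset.sum_sub_distrib, mul_sub, sum_bilin_ridge_inv hn'.le hδ]
    simp
    field_simp
  simp_rw [heq]
  rw [integral_const_mul, integral_finsetSum _ fun i _ =>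
    integrable_bilin_sub h hmean hn hδ hu hv i, abs_mul, abs_of_pos (inv_pos.2 hn')]
  calc _ ≤ (n : ℝ)⁻¹ * ∑ _i : Fin n, bilinError M δ n s := by
        gcongr
        exact (Finset.abs_sum_le_sum_abs _ _).trans (Finset.sum_le_sum fun i _ =>
          abs_integral_pi_bilin_sub_le h hmean hs hvar hd hdn hδ hu hv i)
    _ = _ := by simp; field_simp

theorem integral_abs_mean_weight_sub_le (h : FourthMomentBound P M)
    (hmean : ∀ i, ∫ v, v i ∂P = 0) (hs : 0 < s)
    (hvar : quadVariance P ≤ ENNReal.ofReal (s ^ 2)) (hd : 0 < d) (hdn : d ≤ n) (hδ : 0 < δ) :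
    ∫ x : Fin n → Fin d → ℝ, |1 - d / n + δ * ((n : ℝ)⁻¹ * ((ridge n δ x)⁻¹).trace) -
      traceWeight P n (ridge n δ x)⁻¹| ∂(Measure.pi fun _ => P) ≤ weightError M δ n s := by
  have hn := hd.trans_le hdn
  have hn' : (0 : ℝ) < n := by exact_mod_cast hn
  have hI := fun i : Fin n => integrable_weight_sub h hmean hn hδ i
  refine (integral_mono_of_nonneg (ae_of_all _ fun _ => abs_nonneg _)
    ((integrable_finsetSum Finset.univ fun i _ => hI i).const_mul (n : ℝ)⁻¹)
    (ae_of_all _ fun x => ?_)).trans ?_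
  · have heq : 1 - d / n + δ * ((n : ℝ)⁻¹ * ((ridge n δ x)⁻¹).trace) -
        traceWeight P n (ridge n δ x)⁻¹ = (n : ℝ)⁻¹ * ∑ i,
          (1 - (n : ℝ)⁻¹ * (x i ⬝ᵥ (ridge n δ x)⁻¹ *ᵥ x i) -
            traceWeight P n (ridge n δ x)⁻¹) := by
      rw [Finset.sum_sub_distrib, mul_sub, sum_weight_ridge_inv hn hδ]
      simp
      field_simp
    simp only [heq]
    rw [abs_mul, abs_of_pos (inv_pos.2 hn')]
    gcongr
    exact Finset.abs_sum_le_sum_abs _ _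
  · rw [integral_const_mul, integral_finsetSum _ fun i _ => hI i]
    calc _ ≤ (n : ℝ)⁻¹ * ∑ _i : Fin n, weightError M δ n s := by
          gcongr with i
          exact integral_pi_abs_weight_sub_le h hmean hs hvar hd hdn hδ i
      _ = _ := by simp; field_simp

/-- Total error in the deterministic equivalent of the resolvent. -/
noncomputable def equivError (M δ N s σ p : ℝ) : ℝ :=
  bilinError M δ N s + (1 + M) * δ⁻¹ * weightError M δ N s +
    (δ * (σ⁻¹ + (1 + M) * σ⁻¹ ^ 2) + (1 + (1 + M) * δ⁻¹) * p)

theorem symmCoercive_ridge_of_notMem {σ : ℝ} (hδ : 0 < δ) {x : Fin n → Fin d → ℝ}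
    (hx : x ∉ illConditioned n d σ) : SymmCoercive σ (ridge n δ x) := by
  have hx' : SymmCoercive σ (empCov x) := not_not.1 hx
  exact (hx'.add_smul_one δ).mono (by linarith)

theorem inv_mul_trace_inv_le {B : Matrix (Fin d) (Fin d) ℝ} {N : ℝ} (hδ : 0 < δ)
    (hB : SymmCoercive δ B) (hN : 0 < N) (hdN : d ≤ N) : N⁻¹ * (B⁻¹).trace ≤ δ⁻¹ := by
  rw [← div_eq_inv_mul, div_le_iff₀ hN, mul_comm]
  exact (hB.trace_inv_le hδ).trans (by gcongr)

/-- Replaces the random weight β by 1 - d/n. Since |uᵀΣRv| is bounded by (1+M)δ⁻¹ for every sample,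
L¹ closeness of β to 1 - d/n + δ n⁻¹tr R suffices. -/
theorem abs_sub_integral_bilin_ridge_inv_le (h : FourthMomentBound P M)
    (hmean : ∀ i, ∫ v, v i ∂P = 0) (hs : 0 < s)
    (hvar : quadVariance P ≤ ENNReal.ofReal (s ^ 2)) (hd : 0 < d) (hdn : d ≤ n)
    (hδ : 0 < δ) {σ : ℝ} (hσ : 0 < σ) {u v : Fin d → ℝ} (hu : u ⬝ᵥ u ≤ 1) (hv : v ⬝ᵥ v ≤ 1) :
    |u ⬝ᵥ v - (1 - d / n) * ∫ x : Fin n → Fin d → ℝ, u ⬝ᵥ covMatrix P *ᵥ (ridge n δ x)⁻¹ *ᵥ v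
      ∂(Measure.pi fun _ => P)| ≤
      equivError M δ n s σ ((Measure.pi fun _ => P).real (illConditioned n d σ)) := by
  have hM := h.nonneg
  have hn := hd.trans_le hdn
  have hn' : (0 : ℝ) < n := by exact_mod_cast hn
  have hdn' : (d : ℝ) ≤ n := by exact_mod_cast hdn
  set Q : Measure (Fin n → Fin d → ℝ) := Measure.pi fun _ => P
  set r : (Fin n → Fin d → ℝ) → ℝ := fun x => u ⬝ᵥ (ridge n δ x)⁻¹ *ᵥ v with hr
  set t : (Fin n → Fin d → ℝ) → ℝ := fun x => u ⬝ᵥ covMatrix P *ᵥ (ridge n δ x)⁻¹ *ᵥ v with ht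
  set β : (Fin n → Fin d → ℝ) → ℝ := fun x => traceWeight P n (ridge n δ x)⁻¹ with hβ
  set w : (Fin n → Fin d → ℝ) → ℝ := fun x => (n : ℝ)⁻¹ * ((ridge n δ x)⁻¹).trace with hw
  have hR := fun x : Fin n → Fin d → ℝ => symmCoercive_ridge hn'.le δ x
  have hrc : Continuous r := continuous_bilin_ridge_inv hn'.le hδ u v
  have htc : Continuous t := continuous_bilin_covMatrix_mul_ridge_inv P hn'.le hδ u v
  have hβc : Continuous β := continuous_traceWeight_ridge_inv h hmean hn hδ
  have hwc : Continuous w := continuous_const.mul (continuous_ridge_inv hn'.le hδ).matrix_trace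
  have hrb : ∀ x, |r x| ≤ δ⁻¹ := fun x => (hR x).abs_bilin_inv_le hδ hu hv
  have htb : ∀ x, |t x| ≤ (1 + M) * δ⁻¹ := fun x =>
    abs_bilin_covMatrix_mul_inv_le h hmean hδ (hR x) hu hv
  have hβ0 : ∀ x, 0 ≤ β x := fun x => traceWeight_nonneg h hmean hδ hn' (hR x)
  have hβ1 : ∀ x, β x ≤ 1 := fun x => traceWeight_le_one h hmean hδ hn' (hR x)
  have hw0 : ∀ x, 0 ≤ w x := fun x => mul_nonneg (inv_nonneg.2 hn'.le) ((hR x).trace_inv_nonneg hδ)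
  have hwb : ∀ x, w x ≤ δ⁻¹ := fun x => inv_mul_trace_inv_le hδ (hR x) hn' hdn'
  have hD : 0 < δ⁻¹ := inv_pos.2 hδ
  have hδw : ∀ x, δ * w x ≤ 1 := fun x => by
    calc δ * w x ≤ δ * δ⁻¹ := by gcongr; exact hwb x
      _ = 1 := mul_inv_cancel₀ hδ.ne'
  have huv : |u ⬝ᵥ v| ≤ 1 := by
    simpa using abs_dotProduct_le zero_le_one zero_le_one (hu.trans (by norm_num))
      (hv.trans (by norm_num))
  have hδr : ∀ x, |δ * r x| ≤ 1 := fun x => by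
    rw [abs_mul, abs_of_pos hδ]
    calc δ * |r x| ≤ δ * δ⁻¹ := by gcongr; exact hrb x
      _ = 1 := mul_inv_cancel₀ hδ.ne'
  have hy0 : 0 ≤ (d : ℝ) / n := by positivity
  have hy1 : (d : ℝ) / n ≤ 1 := (div_le_one hn').2 hdn'
  have htβ : ∀ x, |t x * β x| ≤ (1 + M) * δ⁻¹ := fun x => by
    rw [abs_mul, abs_of_nonneg (hβ0 x)]
    exact (mul_le_of_le_one_right (abs_nonneg _) (hβ1 x)).trans (htb x)
  have htw : ∀ x, |t x * (δ * w x)| ≤ (1 + M) * δ⁻¹ := fun x => by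
    rw [abs_mul, abs_of_nonneg (mul_nonneg hδ.le (hw0 x))]
    exact (mul_le_of_le_one_right (abs_nonneg _) (hδw x)).trans (htb x)
  have hτb : ∀ x, |β x - (1 - d / n + δ * w x)| ≤ 2 := fun x => by
    have := hδw x; have := hβ0 x; have := hβ1 x; have := mul_nonneg hδ.le (hw0 x)
    exact abs_le.2 ⟨by linarith, by linarith⟩
  have I1 : Integrable (fun x => u ⬝ᵥ v - δ * r x - t x * β x) Q := by
    refine integrable_pi_of_bounded ((continuous_const.sub (continuous_const.mul hrc)).sub
      (htc.mul hβc)) (c := 1 + 1 + (1 + M) * δ⁻¹) fun x => ?_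
    exact (abs_sub _ _).trans (add_le_add ((abs_sub _ _).trans (add_le_add huv (hδr x))) (htβ x))
  have I2 : Integrable (fun x => t x * (β x - (1 - d / n + δ * w x))) Q := by
    refine integrable_pi_of_bounded (htc.mul (hβc.sub (continuous_const.add
      (continuous_const.mul hwc)))) (c := (1 + M) * δ⁻¹ * 2) fun x => ?_
    rw [abs_mul]
    exact mul_le_mul (htb x) (hτb x) (abs_nonneg _) (by positivity)
  have I3 : Integrable (fun x => δ * r x + t x * (δ * w x)) Q := by
    refine integrable_pi_of_bounded ((continuous_const.mul hrc).add (htc.mul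
      (continuous_const.mul hwc))) (c := 1 + (1 + M) * δ⁻¹) fun x => ?_
    exact (abs_add_le _ _).trans (add_le_add (hδr x) (htw x))
  have It : Integrable t Q := integrable_pi_of_bounded htc htb
  have Iτ : Integrable (fun x => |1 - d / n + δ * w x - β x|) Q := by
    refine integrable_pi_of_bounded ((continuous_const.add (continuous_const.mul hwc)).sub
      hβc).abs (c := 2) fun x => ?_
    rw [abs_abs, abs_sub_comm]
    exact hτb x
  -- The summands are the leave-one-out error, the error in identifying β, and the terms carrying a
  -- factor δ.
  have hsplit : u ⬝ᵥ v - (1 - d / n) * ∫ x, t x ∂Q =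
      ∫ x, (u ⬝ᵥ v - δ * r x - t x * β x) ∂Q + ∫ x, t x * (β x - (1 - d / n + δ * w x)) ∂Q +
        ∫ x, (δ * r x + t x * (δ * w x)) ∂Q := by
    rw [← integral_add' I1 I2, ← integral_add' (I1.add I2) I3]
    have : ∀ x, u ⬝ᵥ v - δ * r x - t x * β x + t x * (β x - (1 - d / n + δ * w x)) +
        (δ * r x + t x * (δ * w x)) = u ⬝ᵥ v - (1 - d / n) * t x := fun x => by ring
    simp_rw [Pi.add_apply, this]
    rw [integral_sub (integrable_const _) (It.const_mul _), integral_const_mul]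
    simp
  rw [hsplit]
  refine (abs_add_three _ _ _).trans (add_le_add (add_le_add ?_ ?_) ?_)
  · exact abs_integral_sub_bilin_mul_traceWeight_le h hmean hs hvar hd hdn hδ hu hv
  · calc |∫ x, t x * (β x - (1 - d / n + δ * w x)) ∂Q|
        ≤ ∫ x, |t x * (β x - (1 - d / n + δ * w x))| ∂Q := abs_integral_le_integral_abs
      _ ≤ ∫ x, (1 + M) * δ⁻¹ * |1 - d / n + δ * w x - β x| ∂Q := by
        refine integral_mono I2.abs (Iτ.const_mul _) fun x => ?_
        simp only
        rw [abs_mul, abs_sub_comm]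
        exact mul_le_mul_of_nonneg_right (htb x) (abs_nonneg _)
      _ ≤ _ := by
        rw [integral_const_mul]
        gcongr
        exact integral_abs_mean_weight_sub_le h hmean hs hvar hd hdn hδ
  · refine abs_integral_le_integral_abs.trans (integral_le_add_mul_measureReal
      (measurableSet_illConditioned n d σ) (by positivity)
      (fun _ => abs_nonneg _) (fun x hx => ?_) fun x => ?_)
    -- For well-conditioned samples σ⁻¹ replaces δ⁻¹ in the bounds, so the factor δ survives; on the
    -- exceptional set only boundedness is available.
    · have hg := symmCoercive_ridge_of_notMem hδ hx
      have e1 : |r x| ≤ σ⁻¹ := hg.abs_bilin_inv_le hσ hu hv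
      have e2 : |t x| ≤ (1 + M) * σ⁻¹ := abs_bilin_covMatrix_mul_inv_le h hmean hσ hg hu hv
      have e3 : w x ≤ σ⁻¹ := inv_mul_trace_inv_le hσ hg hn' hdn'
      refine (abs_add_le _ _).trans ?_
      rw [abs_mul, abs_mul, abs_of_pos hδ, abs_of_nonneg (mul_nonneg hδ.le (hw0 x))]
      calc δ * |r x| + |t x| * (δ * w x) ≤ δ * σ⁻¹ + (1 + M) * σ⁻¹ * (δ * σ⁻¹) := by
            gcongr
            exact mul_nonneg hδ.le (hw0 x)
        _ = _ := by ring
    · exact (abs_add_le _ _).trans (add_le_add (hδr x) (htw x))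

/-- The resolvent identity R - R' = (δ' - δ)RR' gives a bound free of δ⁻¹ on well-conditioned
samples; elsewhere the two resolvents are bounded separately. -/
theorem abs_integral_bilin_ridge_inv_sub_le (P : Measure (Fin d → ℝ)) [IsProbabilityMeasure P]
    {δ' σ : ℝ} (hδ : 0 < δ) (hδδ' : δ ≤ δ') (hσ : 0 < σ) {u v : Fin d → ℝ} (hu : u ⬝ᵥ u ≤ 1)
    (hv : v ⬝ᵥ v ≤ 1) :
    |∫ x : Fin n → Fin d → ℝ, u ⬝ᵥ (ridge n δ x)⁻¹ *ᵥ v ∂(Measure.pi fun _ => P) -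
      ∫ x : Fin n → Fin d → ℝ, u ⬝ᵥ (ridge n δ' x)⁻¹ *ᵥ v ∂(Measure.pi fun _ => P)| ≤
      δ' * σ⁻¹ ^ 2 + 2 * δ⁻¹ * (Measure.pi fun _ => P).real (illConditioned n d σ) := by
  have hδ' := hδ.trans_le hδδ'
  have hn' : (0 : ℝ) ≤ n := n.cast_nonneg
  have hR := fun x : Fin n → Fin d → ℝ => symmCoercive_ridge hn' δ x
  have hR' := fun x : Fin n → Fin d → ℝ => symmCoercive_ridge hn' δ' x
  have hb := fun x => (hR x).abs_bilin_inv_le hδ hu hv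
  have hb' := fun x => (hR' x).abs_bilin_inv_le hδ' hu hv
  have hD : 0 < δ⁻¹ := inv_pos.2 hδ
  rw [← integral_sub (integrable_pi_of_bounded (continuous_bilin_ridge_inv hn' hδ u v) hb)
    (integrable_pi_of_bounded (continuous_bilin_ridge_inv hn' hδ' u v) hb')]
  refine abs_integral_le_integral_abs.trans (integral_le_add_mul_measureReal
    (measurableSet_illConditioned n d σ) (by positivity)
    (fun _ => abs_nonneg _) (fun x hx => ?_) fun x => ?_)
  · have hg := symmCoercive_ridge_of_notMem hδ hx
    have hg' := symmCoercive_ridge_of_notMem hδ' hx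
    have h1 : u ⬝ᵥ (ridge n δ x)⁻¹ *ᵥ v - u ⬝ᵥ (ridge n δ' x)⁻¹ *ᵥ v =
        (δ' - δ) * (((ridge n δ x)⁻¹ *ᵥ u) ⬝ᵥ ((ridge n δ' x)⁻¹ *ᵥ v)) := by
      have e1 : ridge n δ' x *ᵥ (ridge n δ' x)⁻¹ *ᵥ v = v := (hR' x).mulVec_inv_mulVec hδ' v
      have e2 : ridge n δ' x = ridge n δ x + (δ' - δ) • (1 : Matrix (Fin d) (Fin d) ℝ) := by
        rw [ridge, ridge, sub_smul]; abel
      have e3 : (ridge n δ x)⁻¹ *ᵥ v = (ridge n δ' x)⁻¹ *ᵥ v +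
          (δ' - δ) • (ridge n δ x)⁻¹ *ᵥ (ridge n δ' x)⁻¹ *ᵥ v := by
        set z := (ridge n δ' x)⁻¹ *ᵥ v
        rw [← e1, e2, Matrix.add_mulVec, Matrix.smul_mulVec, Matrix.one_mulVec, Matrix.mulVec_add,
          (hR x).inv_mulVec_mulVec hδ, Matrix.mulVec_smul]
      rw [e3, dotProduct_add, add_sub_cancel_left, dotProduct_smul, smul_eq_mul,
        (hR x).inv_isSymm.dotProduct_mulVec_comm]
    rw [h1, abs_mul, abs_of_nonneg (sub_nonneg.2 hδδ')]
    have h2 := abs_dotProduct_le (inv_nonneg.2 hσ.le) (inv_nonneg.2 hσ.le)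
      (hg.inv_mulVec_self_le_of_le_one hσ hu) (hg'.inv_mulVec_self_le_of_le_one hσ hv)
    rw [← pow_two] at h2
    exact mul_le_mul (by linarith) h2 (abs_nonneg _) hδ'.le
  · have h1 : δ'⁻¹ ≤ δ⁻¹ := inv_anti₀ hδ hδδ'
    exact (abs_sub _ _).trans (by linarith [hb x, hb' x])

end DeterministicEquivalent

/-! ### From the product law to the bias of the given sample. -/

section Bias

variable {n d : ℕ}

theorem symmCoercive_of_spectrum {A : Matrix (Fin d) (Fin d) ℝ} (hA : A.IsHermitian) {σ : ℝ}
    (h : ∀ t ∈ spectrum ℝ A, σ ≤ t) : SymmCoercive σ A := by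
  have hsymm : A.IsSymm := by
    rwa [Matrix.IsHermitian, Matrix.conjTranspose_eq_transpose_of_trivial] at hA
  have hpsd : (A - algebraMap ℝ (Matrix (Fin d) (Fin d) ℝ) σ).PosSemidef := by
    rw [Matrix.posSemidef_iff_isHermitian_and_spectrum_nonneg]
    refine ⟨hA.sub ?_, ?_⟩
    · rw [Algebra.algebraMap_eq_smul_one, Matrix.IsHermitian,
        Matrix.conjTranspose_eq_transpose_of_trivial]
      simp
    · rw [← spectrum.sub_singleton_eq]
      rintro _ ⟨t, ht, _, rfl, rfl⟩
      exact sub_nonneg.2 (h t ht)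
  refine ⟨hsymm, fun v => ?_⟩
  have h1 := hpsd.dotProduct_mulVec_nonneg v
  rw [Algebra.algebraMap_eq_smul_one, Matrix.sub_mulVec, Matrix.smul_mulVec, Matrix.one_mulVec,
    dotProduct_sub, dotProduct_smul, smul_eq_mul] at h1
  simpa using h1

theorem empCov_isHermitian (x : Fin n → Fin d → ℝ) : (empCov x).IsHermitian := by
  rw [Matrix.IsHermitian, Matrix.conjTranspose_eq_transpose_of_trivial]
  exact isSymm_smul_sum_vecMulVec _ _

theorem dotProduct_matExp_mulVec {α : Type*} [MeasurableSpace α] {Q : Measure α}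
    {R : α → Matrix (Fin d) (Fin d) ℝ} (hR : ∀ i j, Integrable (fun x => R x i j) Q)
    (u v : Fin d → ℝ) : u ⬝ᵥ matExp Q R *ᵥ v = ∫ x, u ⬝ᵥ R x *ᵥ v ∂Q := by
  have h1 : ∀ A : Matrix (Fin d) (Fin d) ℝ, u ⬝ᵥ A *ᵥ v = ∑ i, ∑ j, (u i * v j) * A i j := by
    intro A
    simp only [dotProduct, Matrix.mulVec, Finset.mul_sum]
    exact Finset.sum_congr rfl fun i _ => Finset.sum_congr rfl fun j _ => by ring
  have h2 : ∫ x, ∑ i, ∑ j, (u i * v j) * R x i j ∂Q =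
      ∑ i, ∑ j, (u i * v j) * ∫ x, R x i j ∂Q :=
    (integral_finsetSum _ fun i _ => integrable_finsetSum _ fun j _ =>
      (hR i j).const_mul _).trans <| Finset.sum_congr rfl fun i _ =>
        (integral_finsetSum _ fun j _ => (hR i j).const_mul _).trans <|
          Finset.sum_congr rfl fun j _ => integral_const_mul _ _
  simp_rw [h1]
  exact h2.symm

theorem integrable_ridge_inv_apply (P : Measure (Fin d → ℝ)) [IsProbabilityMeasure P] {δ : ℝ}
    (hδ : 0 < δ) (i j : Fin d) :
    Integrable (fun x : Fin n → Fin d → ℝ => (ridge n δ x)⁻¹ i j) (Measure.pi fun _ => P) := by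
  have h := integrable_pi_of_bounded (P := P)
    (continuous_bilin_ridge_inv (m := n) n.cast_nonneg hδ (Pi.single i 1) (Pi.single j 1))
    fun x => (symmCoercive_ridge n.cast_nonneg δ x).abs_bilin_inv_le hδ (by simp) (by simp)
  simpa using h

variable {Ω : Type*} [MeasurableSpace Ω] {μ : Measure Ω}
  {P : Measure (Fin d → ℝ)} {X : Fin n → Ω → Fin d → ℝ}

theorem aemeasurable_sample (hlaw : ∀ i, HasLaw (X i) P μ) :
    AEMeasurable (fun ω i => X i ω) μ :=
  aemeasurable_pi_lambda _ fun i => (hlaw i).aemeasurable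

variable [IsProbabilityMeasure μ]

theorem map_sample_eq_pi (hlaw : ∀ i, HasLaw (X i) P μ) (hindep : iIndepFun X μ) :
    μ.map (fun ω i => X i ω) = Measure.pi fun _ => P := by
  rw [(iIndepFun_iff_map_fun_eq_pi_map fun i => (hlaw i).aemeasurable).1 hindep]
  congr 1
  funext i
  exact (hlaw i).map_eq

/-- The factor c⁻¹ is pulled out of the inverse, turning the ridge ε into εc. -/
theorem inv_smul_empCov_add {c : ℝ} (hc : 0 < c) {ε : ℝ} (hε : 0 < ε) (x : Fin n → Fin d → ℝ) :
    (c⁻¹ • empCov x + ε • (1 : Matrix (Fin d) (Fin d) ℝ))⁻¹ = c • (ridge n (ε * c) x)⁻¹ := by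
  refine Matrix.inv_eq_right_inv ?_
  have h : c⁻¹ • empCov x + ε • (1 : Matrix (Fin d) (Fin d) ℝ) = c⁻¹ • ridge n (ε * c) x := by
    rw [ridge_eq_empCov_add, smul_add, smul_smul]
    congr 2
    field_simp
  rw [h, Matrix.smul_mul, Matrix.mul_smul, smul_smul, inv_mul_cancel₀ hc.ne', one_smul,
    Matrix.mul_nonsing_inv _ ((symmCoercive_ridge n.cast_nonneg _ x).isUnit_det (by positivity))]

theorem resolventBias_eq (hlaw : ∀ i, HasLaw (X i) P μ) (hindep : iIndepFun X μ) (hdn : d < n)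
    {ε : ℝ} (hε : 0 < ε) :
    resolventBias μ P X ε = (1 - (d : ℝ) / n) • matExp (Measure.pi fun _ : Fin n => P)
      (fun x => (ridge n (ε * (1 - d / n)) x)⁻¹) - (covMatrix P)⁻¹ := by
  have hn : (0 : ℝ) < n := by exact_mod_cast (Nat.zero_le d).trans_lt hdn
  have hc : 0 < 1 - (d : ℝ) / n := sub_pos.2 ((div_lt_one hn).2 (by exact_mod_cast hdn))
  rw [resolventBias]
  congr 1
  ext i j
  simp only [matExp, Matrix.of_apply, Matrix.smul_apply, smul_eq_mul]
  simp_rw [inv_smul_empCov_add hc hε, Matrix.smul_apply, smul_eq_mul]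
  rw [integral_const_mul, ← map_sample_eq_pi hlaw hindep,
    integral_map (aemeasurable_sample hlaw)]
  exact ((continuous_ridge_inv hn.le (mul_pos hε hc)).matrix_elem i j).aestronglyMeasurable

theorem measureReal_illConditioned_le (hlaw : ∀ i, HasLaw (X i) P μ) (hindep : iIndepFun X μ)
    (σ : ℝ) :
    (Measure.pi fun _ : Fin n => P).real (illConditioned n d σ) ≤ smallEigProb μ X σ := by
  rw [← map_sample_eq_pi hlaw hindep, map_measureReal_apply_of_aemeasurable
    (aemeasurable_sample hlaw) (measurableSet_illConditioned n d σ), smallEigProb]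
  refine measureReal_mono (fun ω hω => ?_)
  by_contra hcon
  refine hω (symmCoercive_of_spectrum (empCov_isHermitian _) fun t ht => ?_)
  by_contra hlt
  exact hcon ⟨t, ht, not_le.1 hlt⟩

variable [IsProbabilityMeasure P] {M s σ σmin ε : ℝ}

/-- The deterministic equivalent controls ΣR; testing it at a multiple of Σ⁻¹u removes Σ, at the
cost of σmin⁻¹. -/
theorem specNorm_resolventBias_le (hlaw : ∀ i, HasLaw (X i) P μ) (hindep : iIndepFun X μ)
    (hd : 0 < d) (hdn : d < n) (h : FourthMomentBound P M) (hmean : ∀ i, ∫ v, v i ∂P = 0)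
    (hs : 0 < s) (hvar : quadVariance P ≤ ENNReal.ofReal (s ^ 2)) (hσmin : 0 < σmin)
    (hcov : SymmCoercive σmin (covMatrix P)) (hσ : 0 < σ) (hε : 0 < ε) :
    specNorm (resolventBias μ P X ε) ≤
      σmin⁻¹ * equivError M (ε * (1 - d / n)) n s σ (smallEigProb μ X σ) := by
  have hn : (0 : ℝ) < n := by exact_mod_cast (Nat.zero_le d).trans_lt hdn
  have hc : 0 < 1 - (d : ℝ) / n := sub_pos.2 ((div_lt_one hn).2 (by exact_mod_cast hdn))
  have hδ := mul_pos hε hc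
  have hM := h.nonneg
  have hp := measureReal_illConditioned_le hlaw hindep σ
  set δ := ε * (1 - (d : ℝ) / n)
  have hmono : equivError M δ n s σ ((Measure.pi fun _ => P).real (illConditioned n d σ)) ≤
      equivError M δ n s σ (smallEigProb μ X σ) := by
    unfold equivError
    gcongr
  have key : ∀ u v : Fin d → ℝ, u ⬝ᵥ u ≤ 1 → v ⬝ᵥ v ≤ 1 →
      |u ⬝ᵥ resolventBias μ P X ε *ᵥ v| ≤
        σmin⁻¹ * equivError M δ n s σ (smallEigProb μ X σ) := by
    intro u v hu hv
    -- The factor σmin keeps the test vector in the unit ball.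
    set u' := σmin • (covMatrix P)⁻¹ *ᵥ u with hu'
    have hu1 : u' ⬝ᵥ u' ≤ 1 := by
      have := hcov.inv_mulVec_self_le_of_le_one hσmin hu
      rw [hu', smul_dotProduct, dotProduct_smul, smul_eq_mul, smul_eq_mul]
      calc _ ≤ σmin * (σmin * σmin⁻¹ ^ 2) := by gcongr
        _ = 1 := by field_simp
    have hmain := (abs_sub_integral_bilin_ridge_inv_le h hmean hs hvar hd hdn.le hδ hσ hu1 hv).trans
      hmono
    have h1 : u' ⬝ᵥ v = σmin * (u ⬝ᵥ (covMatrix P)⁻¹ *ᵥ v) := by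
      rw [hu', smul_dotProduct, smul_eq_mul, hcov.inv_isSymm.dotProduct_mulVec_comm]
    have h2 : ∀ z, u' ⬝ᵥ covMatrix P *ᵥ z = σmin * (u ⬝ᵥ z) := by
      intro z
      rw [hcov.symm.dotProduct_mulVec_comm, hu', Matrix.mulVec_smul, hcov.mulVec_inv_mulVec hσmin,
        smul_dotProduct, smul_eq_mul]
    simp_rw [h1, h2] at hmain
    rw [integral_const_mul, ← dotProduct_matExp_mulVec (integrable_ridge_inv_apply P hδ)] at hmain
    have h3 : u ⬝ᵥ resolventBias μ P X ε *ᵥ v = -(σmin⁻¹ * (σmin * (u ⬝ᵥ (covMatrix P)⁻¹ *ᵥ v) -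
        (1 - d / n) * (σmin * (u ⬝ᵥ matExp (Measure.pi fun _ : Fin n => P)
          (fun x => (ridge n δ x)⁻¹) *ᵥ v)))) := by
      rw [resolventBias_eq hlaw hindep hdn hε, Matrix.sub_mulVec, Matrix.smul_mulVec,
        dotProduct_sub, dotProduct_smul, smul_eq_mul]
      have e : ∀ a b c : ℝ, c * a - b = -(σmin⁻¹ * (σmin * b - c * (σmin * a))) := by
        intro a b c
        field_simp
        ring
      exact e _ _ _
    rw [h3, abs_neg, abs_mul, abs_of_pos (inv_pos.2 hσmin)]
    gcongr
  exact specNorm_le_of_forall_bilin ((abs_nonneg _).trans (key 0 0 (by simp) (by simp))) key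

theorem specNorm_resolventBias_le_add (hlaw : ∀ i, HasLaw (X i) P μ) (hindep : iIndepFun X μ)
    (hdn : d < n) (hσ : 0 < σ) {ε' : ℝ} (hε : 0 < ε) (hεε' : ε ≤ ε') :
    specNorm (resolventBias μ P X ε) ≤ specNorm (resolventBias μ P X ε') +
      (ε' * σ⁻¹ ^ 2 + 2 * (smallEigProb μ X σ / ε)) := by
  have hn : (0 : ℝ) < n := by exact_mod_cast (Nat.zero_le d).trans_lt hdn
  have hc : 0 < 1 - (d : ℝ) / n := sub_pos.2 ((div_lt_one hn).2 (by exact_mod_cast hdn))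
  have hc1 : 1 - (d : ℝ) / n ≤ 1 := sub_le_self _ (by positivity)
  have hε' := hε.trans_le hεε'
  have hp := measureReal_illConditioned_le hlaw hindep σ
  have hp0 : 0 ≤ smallEigProb μ X σ := measureReal_nonneg
  have hdiff : specNorm (resolventBias μ P X ε - resolventBias μ P X ε') ≤
      ε' * σ⁻¹ ^ 2 + 2 * (smallEigProb μ X σ / ε) := by
    refine specNorm_le_of_forall_bilin (by positivity) fun u v hu hv => ?_
    have h1 := abs_integral_bilin_ridge_inv_sub_le (n := n) P (mul_pos hε hc)
      (mul_le_mul_of_nonneg_right hεε' hc.le) hσ hu hv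
    rw [← dotProduct_matExp_mulVec (integrable_ridge_inv_apply P (mul_pos hε hc)),
      ← dotProduct_matExp_mulVec (integrable_ridge_inv_apply P (mul_pos hε' hc))] at h1
    rw [resolventBias_eq hlaw hindep hdn hε, resolventBias_eq hlaw hindep hdn hε',
      sub_sub_sub_cancel_right, Matrix.sub_mulVec, Matrix.smul_mulVec, Matrix.smul_mulVec,
      dotProduct_sub, dotProduct_smul, dotProduct_smul, smul_eq_mul, smul_eq_mul, ← mul_sub,
      abs_mul, abs_of_pos hc]
    set c := 1 - (d : ℝ) / n
    calc _ ≤ c * (ε' * c * σ⁻¹ ^ 2 + 2 * (ε * c)⁻¹ * smallEigProb μ X σ) := by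
          refine mul_le_mul_of_nonneg_left (h1.trans ?_) hc.le
          gcongr
      -- The factor c in front cancels the one in (εc)⁻¹, so the probability term is 2p/ε even
      -- though the ridge is εc.
      _ = c ^ 2 * (ε' * σ⁻¹ ^ 2) + 2 * (smallEigProb μ X σ / ε) := by field_simp
      _ ≤ 1 * (ε' * σ⁻¹ ^ 2) + 2 * (smallEigProb μ X σ / ε) := by
          gcongr
          exact pow_le_one₀ hc.le hc1
      _ = _ := by rw [one_mul]
  have htri : specNorm (resolventBias μ P X ε) ≤ specNorm (resolventBias μ P X ε') +
      specNorm (resolventBias μ P X ε - resolventBias μ P X ε') := by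
    unfold specNorm
    rw [map_sub]
    exact norm_le_norm_add_norm_sub' _ _
  linarith

/-- Treating δ⁻¹ and N⁻¹ as separate variables makes the error a polynomial; at s = N⁻¹ = p = 0 only
the term linear in δ remains. -/
theorem tendsto_equivError {l : Filter ℕ} {δ N s p : ℕ → ℝ} {δ₀ : ℝ} (M σ : ℝ) (hδ₀ : 0 < δ₀)
    (hδ : Tendsto δ l (𝓝 δ₀)) (hN : Tendsto N l atTop) (hs : Tendsto s l (𝓝 0))
    (hp : Tendsto p l (𝓝 0)) :
    Tendsto (fun k => equivError M (δ k) (N k) (s k) σ (p k)) l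
      (𝓝 (δ₀ * (σ⁻¹ + (1 + M) * σ⁻¹ ^ 2))) := by
  let G : ℝ × ℝ × ℝ × ℝ × ℝ → ℝ := fun q =>
    q.2.2.2.1 * (M + 1) * q.2.1 ^ 2 / 2 + q.2.2.1 * ((1 + M) ^ 2 * q.2.1 ^ 2) +
      q.2.2.1 * ((1 + M) * ((1 + M) ^ 2 + 1) * q.2.1 ^ 2 / 2) +
      (1 + M) * q.2.1 * (q.2.2.2.1 * (1 + q.2.1 ^ 2) / 2 + q.2.2.1 * ((1 + M) * q.2.1)) +
      (q.1 * (σ⁻¹ + (1 + M) * σ⁻¹ ^ 2) + (1 + (1 + M) * q.2.1) * q.2.2.2.2)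
  have hG : Continuous G := by fun_prop
  have h := (hG.tendsto (δ₀, δ₀⁻¹, 0, 0, 0)).comp (hδ.prodMk_nhds ((hδ.inv₀ hδ₀.ne').prodMk_nhds
    ((tendsto_inv_atTop_zero.comp hN).prodMk_nhds (hs.prodMk_nhds hp))))
  have h0 : G (δ₀, δ₀⁻¹, 0, 0, 0) = δ₀ * (σ⁻¹ + (1 + M) * σ⁻¹ ^ 2) := by
    simp only [G]; ring
  rw [h0] at h
  exact h

end Bias

/-! ### The two limits. -/

theorem mainTheorem4
    -- sample sizes, dimensions, and the aspect ratio in the limit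
    (n d : ℕ → ℕ) (y : ℝ) (hy : y ∈ Set.Ico (0 : ℝ) 1)
    (hn : Tendsto n atTop atTop) (hd : Tendsto d atTop atTop)
    (hdn : Tendsto (fun k => (d k : ℝ) / n k) atTop (𝓝 y))
    (hlt : ∀ k, d k < n k)
    -- centred population laws
    (P : ∀ k, Measure (Fin (d k) → ℝ)) [∀ k, IsProbabilityMeasure (P k)]
    (hmean : ∀ k i, ∫ v, v i ∂(P k) = 0)
    -- for each `k`, a sample of `n k` independent vectors with law `P k`
    (Ω : ℕ → Type*) [∀ k, MeasurableSpace (Ω k)]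
    (μ : ∀ k, Measure (Ω k)) [∀ k, IsProbabilityMeasure (μ k)]
    (X : ∀ k, Fin (n k) → Ω k → Fin (d k) → ℝ)
    (hlaw : ∀ k i, HasLaw (X k i) (P k) (μ k))
    (hindep : ∀ k, iIndepFun (X k) (μ k))
    -- A1: the empirical spectral distributions of the covariances converge almost everywhere
    (F : ℝ → ℝ)
    (hA1 : ∀ᵐ u ∂(volume.restrict (Set.Ici (0 : ℝ))),
      Tendsto (fun k => esd (covMatrix_isHermitian (P k)) u) atTop (𝓝 (F u)))
    -- A2: `M` stays bounded and `ν` vanishes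
    (hM : ∃ C : ℝ≥0∞, C ≠ ∞ ∧ ∀ k, fourthMoment (P k) ≤ C)
    (hν : Tendsto (fun k => quadVariance (P k)) atTop (𝓝 0))
    -- A3: the eigenvalues of the covariances lie in a fixed interval
    (σmin σmax : ℝ) (hσmin : 0 < σmin)
    (hA3 : ∀ k, spectrum ℝ (covMatrix (P k)) ⊆ Set.Icc σmin σmax)
    -- the eigenvalues of the empirical covariances are bounded away from zero, in probability
    (σ : ℝ) (hσ : 0 < σ)
    (hemp : Tendsto (fun k => smallEigProb (μ k) (X k) σ) atTop (𝓝 0)) :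
    -- `n, d → ∞` and `ε → 0` simultaneously
    (∀ ε : ℕ → ℝ, (∀ k, 0 < ε k) → Tendsto ε atTop (𝓝 0) →
      (fun k => smallEigProb (μ k) (X k) σ) =o[atTop] ε →
      Tendsto (fun k => specNorm (resolventBias (μ k) (P k) (X k) (ε k))) atTop (𝓝 0)) ∧
    -- `n, d → ∞` first, then `ε → 0`
    (∀ η : ℝ, 0 < η → ∀ᶠ ε in 𝓝[>] (0 : ℝ), ∀ᶠ k in atTop,
      specNorm (resolventBias (μ k) (P k) (X k) ε) < η) := by
  obtain ⟨C, hC, hMC⟩ := hM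
  have h4 : ∀ k, FourthMomentBound (P k) C.toReal := fun k => fourthMomentBound_of_le hC (hMC k)
  set M := C.toReal
  have hM0 : 0 ≤ M := ENNReal.toReal_nonneg
  have hcov : ∀ k, SymmCoercive σmin (covMatrix (P k)) := fun k =>
    symmCoercive_of_spectrum (covMatrix_isHermitian _) fun t ht => (hA3 k ht).1
  have hnR : Tendsto (fun k => (n k : ℝ)) atTop atTop := tendsto_natCast_atTop_atTop.comp hn
  have hn0 : ∀ k, (0 : ℝ) < n k := fun k => by exact_mod_cast (Nat.zero_le _).trans_lt (hlt k)
  -- The summand 1/n makes s strictly positive, as the division by s requires, without spoiling s →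
  -- 0.
  set s : ℕ → ℝ := fun k => √((quadVariance (P k)).toReal + (n k : ℝ)⁻¹) with hs
  have hs0 : ∀ k, 0 < s k := fun k => Real.sqrt_pos.2
    (add_pos_of_nonneg_of_pos ENNReal.toReal_nonneg (inv_pos.2 (hn0 k)))
  have hst : Tendsto s atTop (𝓝 0) := by
    have h1 := (ENNReal.tendsto_toReal ENNReal.zero_ne_top).comp hν
    have h2 := (Real.continuous_sqrt.tendsto _).comp (h1.add (tendsto_inv_atTop_zero.comp hnR))
    rw [ENNReal.toReal_zero, add_zero, Real.sqrt_zero] at h2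
    exact h2
  have hvar : ∀ᶠ k in atTop, quadVariance (P k) ≤ ENNReal.ofReal (s k ^ 2) := by
    -- The real value of ν is faithful only once ν is finite, which holds eventually.
    filter_upwards [hν.eventually_lt_const ENNReal.zero_lt_top] with k hk
    rw [hs, Real.sq_sqrt (add_nonneg ENNReal.toReal_nonneg (inv_pos.2 (hn0 k)).le)]
    refine (ENNReal.le_ofReal_iff_toReal_le hk.ne ?_).2 ?_
    · exact add_nonneg ENNReal.toReal_nonneg (inv_pos.2 (hn0 k)).le
    · exact le_add_of_nonneg_right (inv_pos.2 (hn0 k)).le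
  have iterated : ∀ η : ℝ, 0 < η → ∀ᶠ ε in 𝓝[>] (0 : ℝ), ∀ᶠ k in atTop,
      specNorm (resolventBias (μ k) (P k) (X k) ε) < η := by
    intro η hη
    have hsmall : ∀ᶠ ε in 𝓝[>] (0 : ℝ),
        σmin⁻¹ * (ε * (1 - y) * (σ⁻¹ + (1 + M) * σ⁻¹ ^ 2)) < η := by
      have hc : Continuous fun ε : ℝ =>
          σmin⁻¹ * (ε * (1 - y) * (σ⁻¹ + (1 + M) * σ⁻¹ ^ 2)) := by fun_prop
      have := hc.tendsto 0
      simp only [zero_mul, mul_zero] at this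
      exact (this.mono_left nhdsWithin_le_nhds).eventually_lt_const hη
    filter_upwards [hsmall, self_mem_nhdsWithin] with ε hε hε0
    have hε0 : 0 < ε := hε0
    have hlim := (tendsto_equivError M σ (mul_pos hε0 (sub_pos.2 hy.2))
      ((hdn.const_sub 1).const_mul ε) hnR hst hemp).const_mul σmin⁻¹
    filter_upwards [hlim.eventually_lt_const hε, hvar, hd.eventually_gt_atTop 0] with k h1 h2 h3
    exact (specNorm_resolventBias_le (hlaw k) (hindep k) h3 (hlt k) (h4 k) (hmean k) (hs0 k) h2
      hσmin (hcov k) hσ hε0).trans_lt h1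
  refine ⟨fun ε hε0 hε hp => ?_, iterated⟩
  have hratio := hp.tendsto_div_nhds_zero
  rw [Metric.tendsto_atTop']
  suffices h : ∀ η : ℝ, 0 < η → ∀ᶠ k in atTop,
      specNorm (resolventBias (μ k) (P k) (X k) (ε k)) < η by
    intro η hη
    obtain ⟨k₀, hk₀⟩ := eventually_atTop.1 (h η hη)
    refine ⟨k₀, fun k hk => ?_⟩
    rw [Real.dist_eq, sub_zero, abs_of_nonneg (specNorm_nonneg _)]
    exact hk₀ k hk.le
  intro η hη
  have hsmall : ∀ᶠ ε' in 𝓝[>] (0 : ℝ), ε' * σ⁻¹ ^ 2 < η / 3 := by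
    have hc : Continuous fun ε' : ℝ => ε' * σ⁻¹ ^ 2 := by fun_prop
    have := hc.tendsto 0
    simp only [zero_mul] at this
    exact (this.mono_left nhdsWithin_le_nhds).eventually_lt_const (by positivity)
  -- A single ε' serves all large k: η/3 for the bias at ε', η/3 for ε'σ⁻², and 2·η/6 for the
  -- probability term.
  obtain ⟨ε', h1, h2, h3⟩ :=
    ((iterated (η / 3) (by positivity)).and (hsmall.and self_mem_nhdsWithin)).exists
  have h3 : 0 < ε' := h3
  filter_upwards [h1, hε.eventually_lt_const h3,
    hratio.eventually_lt_const (show (0 : ℝ) < η / 6 by positivity)] with k e1 e2 e3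
  have := specNorm_resolventBias_le_add (hlaw k) (hindep k) (hlt k) hσ (hε0 k) e2.le
  linarith
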